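/- A finite ringed space is a pair $(X,\mathcal O)$ where $X$ is a finite topological space and $\mathcal O$ is a sheaf of commutative rings with unit on $X$. For $x\in X$ let $U_x$ be the smallest open subset of $X$ containing $x$; the stalk of $\mathcal O$ at $x$ is $\mathcal O_x=\mathcal O(U_x)$. A ringed space $(Y,\mathcal O_Y)$ is called acyclic if $H^i(Y,\mathcal O_Y)=0$ for all $i>0$; an open subset $U\subseteq X$ is called acyclic if $(U,\mathcal O|_U)$ is. A finite ringed space $(X,\mathcal O)$ is called affine if 1. the restriction homomorphism $\mathcal O(X)\to\prod_{x\in X}\mathcal O_x$ is faithfully flat; 2. for all $x,y\in X$ the canonical homomorphism $\mathcal O_x\otimes_{\mathcal O(X)}\mathcal O_y\to\mathcal O(U_x\cap U_y)$ is an isomorphism; 3. for all $x,y\in X$ the restriction homomorphism $\mathcal O(U_x\cap U_y)\to\prod_{z\in U_x\cap U_y}\mathcal O_z$ is faithfully flat. Theorem. Let $(X,\mathcal O)$ be a finite ringed space such that the restriction homomorphism $\mathcal O(X)\to\mathcal O_x$ is flat for every $x\in X$. Then $X$ is affine if and only if the following three conditions hold: 1'. $X$ is acyclic; 2'. for all $x,y\in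 X$ the canonical homomorphism $\mathcal O_x\otimes_{\mathcal O(X)}\mathcal O_y\to\mathcal O(U_x\cap U_y)$ is an isomorphism; 3'. for all $x,y\in X$ the open subset $U_x\cap U_y$ is acyclic. -/

import Mathlib

universe u

open CategoryTheory TopologicalSpace Opposite AlgebraicGeometry
open scoped TensorProduct

namespace FiniteRingedSpace

noncomputable section

/-- The smallest open subset `U_x` containing a point `x` of a finite ringed space. -/
def minOpen (X : RingedSpace.{u, u}) [Finite X] (x : X) : Opens X :=
  ⟨nhdsKer {x}, isOpen_nhdsKer⟩

theorem mem_minOpen (X : RingedSpace.{u, u}) [Finite X] (x : X) : x ∈ minOpen X x :=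
  subset_nhdsKer (Set.mem_singleton x)

theorem minOpen_le (X : RingedSpace.{u, u}) [Finite X] {x : X} {U : Opens X} (h : x ∈ U) :
    minOpen X x ≤ U :=
  nhdsKer_minimal (Set.singleton_subset_iff.2 h) U.isOpen

/-- The ring of sections `𝒪(U)`. -/
abbrev sections (X : RingedSpace.{u, u}) (U : Opens X) : CommRingCat.{u} :=
  X.presheaf.obj (op U)

/-- The restriction homomorphism `𝒪(U) → 𝒪(V)` for `V ⊆ U`. -/
abbrev res (X : RingedSpace.{u, u}) {U V : Opens X} (h : V ≤ U) :
    sections X U →+* sections X V :=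
  (X.presheaf.map (homOfLE h).op).hom

/-- The local ring of functions `𝒪_x` at a point `x` of a finite ringed space, realised as
`𝒪(U_x)`; the germ map identifies it with the stalk at `x`, see `germ_minOpen_bijective`. -/
abbrev localRing (X : RingedSpace.{u, u}) [Finite X] (x : X) : CommRingCat.{u} :=
  sections X (minOpen X x)

theorem germ_minOpen_bijective (X : RingedSpace.{u, u}) [Finite X] (x : X) :
    Function.Bijective (X.presheaf.germ (minOpen X x) x (mem_minOpen X x)) := by
  constructor
  · intro s t hst
    obtain ⟨W, hxW, i, j, hW⟩ := TopCat.Presheaf.germ_eq X.presheaf x _ _ s t hst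
    have hk := congrArg (res X (minOpen_le X hxW)) hW
    have e : ∀ (k : W ⟶ minOpen X x) (a : localRing X x),
        res X (minOpen_le X hxW) (X.presheaf.map k.op a) = a := by
      intro k a
      change (X.presheaf.map k.op ≫ X.presheaf.map (homOfLE (minOpen_le X hxW)).op) a = a
      rw [← X.presheaf.map_comp, ← op_comp,
        Subsingleton.elim (homOfLE (minOpen_le X hxW) ≫ k) (𝟙 _), op_id, X.presheaf.map_id]
      rfl
    rw [e i s, e j t] at hk
    exact hk
  · intro a
    obtain ⟨V, hxV, g, rfl⟩ := X.presheaf.exists_germ_eq a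
    exact ⟨res X (minOpen_le X hxV) g,
      X.presheaf.germ_res_apply (homOfLE (minOpen_le X hxV)) x (mem_minOpen X x) g⟩

/-- The open subset `U_{xy} = U_x ∩ U_y`. -/
abbrev interOpen (X : RingedSpace.{u, u}) [Finite X] (x y : X) : Opens X :=
  minOpen X x ⊓ minOpen X y

/-- The homomorphism `𝒪(U) → ∏_{z ∈ U} 𝒪_z` whose components are the restrictions. -/
def toProd (X : RingedSpace.{u, u}) [Finite X] (U : Opens X) :
    sections X U →+* ((z : U) → localRing X z.1) :=
  RingHom.pi fun z : U => res X (minOpen_le X z.2)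

/-- `𝒪(U)` as an algebra over the ring `𝒪(X)` of global sections, through restriction. -/
abbrev globalAlgebra (X : RingedSpace.{u, u}) (U : Opens X) :
    Algebra (sections X ⊤) (sections X U) :=
  (res X (le_top : U ≤ ⊤)).toAlgebra

/-- Restriction `𝒪(U) → 𝒪(V)` as a homomorphism of `𝒪(X)`-algebras. -/
def resAlgHom (X : RingedSpace.{u, u}) {U V : Opens X} (h : V ≤ U) :
    letI := globalAlgebra X U
    letI := globalAlgebra X V
    sections X U →ₐ[sections X ⊤] sections X V :=
  letI := globalAlgebra X U
  letI := globalAlgebra X V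
  { res X h with
    commutes' := fun r => by
      change (X.presheaf.map (homOfLE le_top).op ≫ X.presheaf.map (homOfLE h).op) r = _
      rw [← X.presheaf.map_comp]
      rfl }

/-- `𝒪_x ⊗_{𝒪(X)} 𝒪_y = 𝒪(U_x ∩ U_y)`: the canonical homomorphism
`a ⊗ b ↦ a|_{U_x ∩ U_y} · b|_{U_x ∩ U_y}` is an isomorphism. -/
def TensorEqInter (X : RingedSpace.{u, u}) [Finite X] (x y : X) : Prop :=
  letI := globalAlgebra X (minOpen X x)
  letI := globalAlgebra X (minOpen X y)
  letI := globalAlgebra X (interOpen X x y)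
  Function.Bijective
    (Algebra.TensorProduct.productMap
      (resAlgHom X (inf_le_left : interOpen X x y ≤ minOpen X x))
      (resAlgHom X (inf_le_right : interOpen X x y ≤ minOpen X y)) :
      localRing X x ⊗[sections X ⊤] localRing X y →ₐ[sections X ⊤] sections X (interOpen X x y))

/-- Affine finite spaces. -/
structure IsAffine (X : RingedSpace.{u, u}) [Finite X] : Prop where
  faithfullyFlat_global : (toProd X ⊤).FaithfullyFlat
  tensor_eq : ∀ x y : X, TensorEqInter X x y
  faithfullyFlat_inter : ∀ x y : X, (toProd X (interOpen X x y)).FaithfullyFlat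

/-- `X` is flat over its ring of global sections: every `𝒪(X) → 𝒪_x` is flat. -/
def IsFlatOverGlobal (X : RingedSpace.{u, u}) [Finite X] : Prop :=
  ∀ x : X, (res X (le_top : minOpen X x ≤ ⊤)).Flat

/-- The structure sheaf of a ringed space as a sheaf of abelian groups. -/
def abSheaf (X : RingedSpace.{u, u}) :
    Sheaf (Opens.grothendieckTopology X) AddCommGrpCat.{u} :=
  (sheafCompose (Opens.grothendieckTopology X)
    (forget₂ CommRingCat.{u} RingCat.{u} ⋙ forget₂ RingCat.{u} AddCommGrpCat.{u})).obj X.sheaf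

/-- A ringed space is acyclic if `Hⁿ(X, 𝒪) = 0` for all `n > 0`. -/
def IsAcyclic (X : RingedSpace.{u, u}) : Prop :=
  ∀ n : ℕ, 0 < n → Subsingleton (Sheaf.H.{u} (abSheaf X) n)

/-- The open subset `U` with the restricted sheaf of rings. -/
abbrev openSubspace (X : RingedSpace.{u, u}) (U : Opens X) : RingedSpace.{u, u} :=
  X.restrict U.isOpenEmbedding

end

end FiniteRingedSpace

/-! Cohomology of a finite space can be computed on its T₀ quotient, a finite poset, where a sheaf
of modules is a functor `F`. It embeds in the product `cofree` of its skyscrapers, which is flasque;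
iterating the cokernel gives a Godement resolution, and acyclicity becomes surjectivity on sections
at each stage (`AcyclicUpTo`, matched with sheaf cohomology by `forall_subsingleton_H_iff`). Only
finite products occur, so the resolution is compatible with tensor products.

Affine implies acyclic: let `U` be `X` or some `U_x ∩ U_z`, and let `y ∈ U`. Condition 2 identifies
`𝒪_y ⊗_{𝒪(U)} 𝒪` with the direct image on `U` of `𝒪` restricted to `U_y`. The higher direct images
are governed by the sets `U_p ∩ U_y`, acyclic by induction on `U`, and `U_y` is acyclic because it
corresponds to a principal upper set. So the direct image is acyclic, and acyclicity descends along
the faithfully flat map `𝒪(U) → ∏ 𝒪_y` (`acyclicUpTo_of_tensorIso`).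

Conversely, if `𝒪` is acyclic on `U` with stalks flat over `𝒪(U)`, the resolution of `𝒪(U)` is an
exact complex of flat modules and stays exact after tensoring with any `N`. Hence `N ⊗ 𝒪_z = 0` for
all `z ∈ U` forces `N = N ⊗ 𝒪(U) = 0` (`sections_flat_and_subsingleton`). For `U = U_x ∩ U_y`
flatness is known only over `𝒪(X)`. But `𝒪_x ⊗ 𝒪_x = 𝒪_x` makes `𝒪(X) → 𝒪_x` a ring epimorphism,
hence so is `𝒪(X) → 𝒪(U_x ∩ U_y)`, and a module over the target of an epimorphism that is flat over
the source is flat over the target. -/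

noncomputable section

/-! ### Modules on a preorder and their Godement resolution -/

/-- A functor from a preorder `P` to `A`-modules. When `P` is finite, these are the sheaves of
`A`-modules on `P` with the topology of upper sets. -/
structure PosetModule (A : Type u) [CommRing A] (P : Type u) [Preorder P] where
  obj : P → Type u
  [addCommGroup : ∀ p, AddCommGroup (obj p)]
  [module : ∀ p, Module A (obj p)]
  map : ∀ {p q : P}, p ≤ q → obj p →ₗ[A] obj q
  map_id : ∀ (p : P) (x : obj p), map le_rfl x = x
  map_map : ∀ {p q r : P} (h : p ≤ q) (h' : q ≤ r) (x : obj p),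
    map h' (map h x) = map (h.trans h') x

namespace PosetModule

attribute [instance] PosetModule.addCommGroup PosetModule.module

variable {A : Type u} [CommRing A] {P : Type u} [Preorder P]

/-- Morphisms of `PosetModule`s. -/
structure Hom (F G : PosetModule A P) where
  app : ∀ p, F.obj p →ₗ[A] G.obj p
  naturality : ∀ {p q : P} (h : p ≤ q) (x : F.obj p), app q (F.map h x) = G.map h (app p x)

/-- The module of sections over a subset `U`, that is, the limit of the restriction to `U`. -/
def sections (F : PosetModule A P) (U : Set P) : Submodule A ((p : U) → F.obj p) where
  carrier := {s | ∀ (p q : U) (h : p.1 ≤ q.1), F.map h (s p) = s q}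
  add_mem' hs ht p q h := by simp [hs p q h, ht p q h]
  zero_mem' p q h := by simp
  smul_mem' a s hs p q h := by simp [hs p q h]

/-- Restriction of sections to a smaller subset. -/
def restrict (F : PosetModule A P) {U V : Set P} (h : V ⊆ U) : F.sections U →ₗ[A] F.sections V where
  toFun s := ⟨fun p => s.1 ⟨p, h p.2⟩, fun p q hpq => s.2 ⟨p, h p.2⟩ ⟨q, h q.2⟩ hpq⟩
  map_add' _ _ := rfl
  map_smul' _ _ := rfl

namespace Hom

variable {F G : PosetModule A P}

/-- The map induced on sections. -/
def sections (f : Hom F G) (U : Set P) : F.sections U →ₗ[A] G.sections U where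
  toFun s := ⟨fun p => f.app p (s.1 p), fun p q h => by rw [← f.naturality, s.2 p q h]⟩
  map_add' s t := by ext; simp
  map_smul' a s := by ext; simp

@[simp] theorem sections_apply (f : Hom F G) (U : Set P) (s : F.sections U) (p : U) :
    (f.sections U s).1 p = f.app p (s.1 p) := rfl

end Hom

section Cofree

/-- The product of the skyscrapers with values `M p`. -/
def cofree (M : P → Type u) [∀ p, AddCommGroup (M p)] [∀ p, Module A (M p)] :
    PosetModule A P where
  obj p := (q : Set.Ici p) → M q
  map h :=
    { toFun := fun s q => s ⟨q, h.trans q.2⟩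
      map_add' := fun _ _ => rfl
      map_smul' := fun _ _ => rfl }
  map_id _ _ := rfl
  map_map _ _ _ := rfl

variable (M : P → Type u) [∀ p, AddCommGroup (M p)] [∀ p, Module A (M p)]

variable {M} in
@[ext] theorem cofree_ext {p : P} {s t : (cofree (A := A) M).obj p}
    (h : ∀ q : Set.Ici p, s q = t q) : s = t :=
  funext h

/-- Sections of a product of skyscrapers over an upper set. -/
def cofreeSections {U : Set P} (hU : IsUpperSet U) :
    (cofree (A := A) M).sections U ≃ₗ[A] ((p : U) → M p) where
  toFun s p := s.1 p ⟨p, le_rfl⟩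
  map_add' _ _ := rfl
  map_smul' _ _ := rfl
  invFun t := ⟨fun p q => t ⟨q, hU q.2 p.2⟩, fun _ _ _ => rfl⟩
  left_inv s := by
    ext p q
    exact (congrFun (s.2 p ⟨q, hU q.2 p.2⟩ q.2) ⟨q, le_rfl⟩).symm
  right_inv _ := rfl

theorem cofree_section_apply {U : Set P} (s : (cofree (A := A) M).sections U) (p q : U)
    (h : p.1 ≤ q.1) : s.1 p ⟨q, h⟩ = s.1 q ⟨q, le_rfl⟩ :=
  congrFun (s.2 p q h) ⟨q, le_rfl⟩

end Cofree

/-- The embedding of `F` into the product of its skyscrapers. -/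
def unit (F : PosetModule A P) : Hom F (cofree F.obj) where
  app p :=
    { toFun := fun x q => F.map q.2 x
      map_add' := fun x y => by ext; exact map_add _ _ _
      map_smul' := fun a x => by ext; exact map_smul _ _ _ }
  naturality h x := by
    ext q
    exact F.map_map h q.2 x

theorem unit_app_apply (F : PosetModule A P) (p : P) (x : F.obj p) (q : Set.Ici p) :
    F.unit.app p x q = F.map q.2 x := rfl

theorem unit_injective (F : PosetModule A P) (p : P) : Function.Injective (F.unit.app p) := by
  intro x y h
  have := congrFun h ⟨p, le_rfl⟩
  rwa [unit_app_apply, unit_app_apply, F.map_id, F.map_id] at this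

/-- The cokernel of the embedding of `F` into the product of its skyscrapers. -/
def coker (F : PosetModule A P) : PosetModule A P where
  obj p := ((cofree (A := A) F.obj).obj p) ⧸ LinearMap.range (F.unit.app p)
  map h := Submodule.mapQ _ _ ((cofree F.obj).map h) (by
    rintro _ ⟨x, rfl⟩
    exact ⟨F.map h x, F.unit.naturality h x⟩)
  map_id _ x := by
    obtain ⟨x, rfl⟩ := Submodule.mkQ_surjective _ x
    rfl
  map_map h h' x := by
    obtain ⟨x, rfl⟩ := Submodule.mkQ_surjective _ x
    rfl

/-- The projection to the cokernel. -/
def proj (F : PosetModule A P) : Hom (cofree F.obj) F.coker where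
  app _ := Submodule.mkQ _
  naturality _ _ := rfl

theorem proj_surjective (F : PosetModule A P) (p : P) : Function.Surjective (F.proj.app p) :=
  Submodule.mkQ_surjective _

theorem exact_unit_proj (F : PosetModule A P) (p : P) :
    Function.Exact (F.unit.app p) (F.proj.app p) :=
  LinearMap.exact_map_mkQ_range _

/-- Vanishing of the first cohomology group over `U`. -/
def H1Vanishes (F : PosetModule A P) (U : Set P) : Prop :=
  Function.Surjective (F.proj.sections U)

/-- Vanishing of the cohomology over `U` in the degrees `1, …, n`. -/
def AcyclicUpTo : ℕ → PosetModule A P → Set P → Prop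
  | 0, _, _ => True
  | n + 1, F, U => F.H1Vanishes U ∧ AcyclicUpTo n F.coker U

/-! ### Retracts of products of skyscrapers -/

section RelInjective

/-- `F` is a retract of a product of skyscrapers. -/
def RelInjective (F : PosetModule A P) : Prop :=
  ∃ r : Hom (cofree F.obj) F, ∀ p x, r.app p (F.unit.app p x) = x

/-- Local lifts can be normalised by the retraction: subtracting `unit (r t)` from a lift `t` makes
it depend only on its class in the cokernel, so the normalised lifts are compatible. -/
theorem RelInjective.h1Vanishes {F : PosetModule A P} (hF : F.RelInjective) (U : Set P) :
    F.H1Vanishes U := by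
  obtain ⟨r, hr⟩ := hF
  intro s
  choose t ht using fun p : U => F.proj_surjective p (s.1 p)
  refine ⟨⟨fun p => t p - F.unit.app p (r.app p (t p)), fun p q h => ?_⟩, ?_⟩
  · have h1 : F.proj.app q ((cofree F.obj).map h (t p) - t q) = 0 := by
      rw [map_sub, F.proj.naturality, ht, ht, s.2 p q h, sub_self]
    obtain ⟨x, hx⟩ := (F.exact_unit_proj q _).1 h1
    have h2 : r.app q ((cofree F.obj).map h (t p)) - r.app q (t q) = x := by
      rw [← map_sub, ← hx, hr]
    rw [map_sub, ← F.unit.naturality, ← r.naturality, sub_eq_sub_iff_sub_eq_sub, ← map_sub, h2, hx]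
  · ext p
    have : F.proj.app p (F.unit.app p (r.app p (t p))) = 0 := (F.exact_unit_proj p _).2 ⟨_, rfl⟩
    simp only [Hom.sections_apply, map_sub, this, ht, sub_zero]

/-- A product of maps, as a morphism of products of skyscrapers. -/
def cofreeMap {M N : P → Type u} [∀ p, AddCommGroup (M p)] [∀ p, Module A (M p)]
    [∀ p, AddCommGroup (N p)] [∀ p, Module A (N p)] (f : ∀ p, M p →ₗ[A] N p) :
    Hom (cofree (A := A) M) (cofree N) where
  app p :=
    { toFun := fun s q => f q (s q)
      map_add' := fun _ _ => by ext; exact map_add _ _ _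
      map_smul' := fun _ _ => by ext; exact map_smul _ _ _ }
  naturality _ _ := rfl

/-- The retraction splits the embedding, so `id - unit ∘ r` induces a section `i` of the projection.
The cokernel is thus a retract of a product of skyscrapers, and reading `i` at the diagonal points
gives the required retraction. -/
theorem RelInjective.coker {F : PosetModule A P} (hF : F.RelInjective) : F.coker.RelInjective := by
  obtain ⟨r, hr⟩ := hF
  have key : ∀ p, LinearMap.range (F.unit.app p) ≤
      LinearMap.ker (LinearMap.id - F.unit.app p ∘ₗ r.app p) := by
    rintro p _ ⟨x, rfl⟩
    simp [hr]
  let i : ∀ p, F.coker.obj p →ₗ[A] (cofree F.obj).obj p := fun p =>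
    Submodule.liftQ _ (LinearMap.id - F.unit.app p ∘ₗ r.app p) (key p)
  have hi : ∀ p t, i p (F.proj.app p t) = t - F.unit.app p (r.app p t) := fun p t => rfl
  have hin : ∀ {p q : P} (h : p ≤ q) (x : F.coker.obj p),
      i q (F.coker.map h x) = (cofree F.obj).map h (i p x) := by
    intro p q h x
    obtain ⟨t, rfl⟩ := F.proj_surjective p x
    rw [← F.proj.naturality, hi, hi, map_sub, ← F.unit.naturality, ← r.naturality]
  refine ⟨⟨fun p => F.proj.app p ∘ₗ
    { toFun := fun s q => i q (s q) ⟨q, le_rfl⟩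
      map_add' := fun s t => by
        ext q
        exact congrFun (map_add (i q) (s q) (t q)) ⟨q, le_rfl⟩
      map_smul' := fun a s => by
        ext q
        exact congrFun (map_smul (i q) a (s q)) ⟨q, le_rfl⟩ }, fun h x => rfl⟩, fun p x => ?_⟩
  obtain ⟨t, rfl⟩ := F.proj_surjective p x
  have h0 : F.proj.app p (F.unit.app p (r.app p t)) = 0 := (F.exact_unit_proj p _).2 ⟨_, rfl⟩
  have h1 : F.proj.app p (i p (F.proj.app p t)) = F.proj.app p t := by
    rw [hi, map_sub, h0, sub_zero]
  refine Eq.trans ?_ h1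
  refine congrArg (F.proj.app p) ?_
  ext q
  exact congrFun (hin q.2 (F.proj.app p t)) ⟨q, le_rfl⟩

theorem RelInjective.acyclicUpTo (n : ℕ) {F : PosetModule A P} (hF : F.RelInjective) (U : Set P) :
    AcyclicUpTo n F U := by
  induction n generalizing F with
  | zero => trivial
  | succ n ih => exact ⟨hF.h1Vanishes U, ih hF.coker⟩

end RelInjective

/-! ### Short exact sequences and dimension shifting -/

section ShortExact

variable {F G H : PosetModule A P}

/-- Short exact sequences over a subset `U`. -/
structure ShortExactOn (f : Hom F G) (g : Hom G H) (U : Set P) : Prop where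
  injective : ∀ p ∈ U, Function.Injective (f.app p)
  exact : ∀ p ∈ U, Function.Exact (f.app p) (g.app p)
  surjective : ∀ p ∈ U, Function.Surjective (g.app p)

theorem shortExactOn_unit_proj (F : PosetModule A P) (U : Set P) :
    ShortExactOn F.unit F.proj U :=
  ⟨fun p _ => F.unit_injective p, fun p _ => F.exact_unit_proj p, fun p _ => F.proj_surjective p⟩

theorem ShortExactOn.sections_injective {f : Hom F G} {g : Hom G H} {U : Set P}
    (h : ShortExactOn f g U) : Function.Injective (f.sections U) := by
  intro s t hst
  ext p
  exact h.injective p p.2 (congrFun (congrArg Subtype.val hst) p)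

theorem ShortExactOn.sections_exact {f : Hom F G} {g : Hom G H} {U : Set P}
    (h : ShortExactOn f g U) : Function.Exact (f.sections U) (g.sections U) := by
  intro s
  constructor
  · intro hs
    have h1 : ∀ p : U, g.app p (s.1 p) = 0 := fun p => congrFun (congrArg Subtype.val hs) p
    choose t ht using fun p : U => (h.exact p p.2 _).1 (h1 p)
    refine ⟨⟨t, fun p q hpq => h.injective q q.2 ?_⟩, ?_⟩
    · rw [f.naturality, ht, ht, s.2 p q hpq]
    · ext p
      exact ht p
  · rintro ⟨t, rfl⟩
    ext p
    exact (h.exact p p.2 _).2 ⟨_, rfl⟩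

/-- The map induced on cokernels. -/
def Hom.coker (f : Hom F G) : Hom F.coker G.coker where
  app p := Submodule.mapQ _ _ ((cofreeMap f.app).app p) (by
    rintro _ ⟨x, rfl⟩
    refine ⟨f.app p x, ?_⟩
    ext q
    exact (f.naturality q.2 x).symm)
  naturality h x := by
    obtain ⟨x, rfl⟩ := F.proj_surjective _ x
    rfl

theorem Hom.coker_proj (f : Hom F G) (p : P) (t : (cofree F.obj).obj p) :
    f.coker.app p (F.proj.app p t) = G.proj.app p ((cofreeMap f.app).app p t) := rfl

theorem Hom.cofreeMap_unit (f : Hom F G) (p : P) (x : F.obj p) :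
    (cofreeMap f.app).app p (F.unit.app p x) = G.unit.app p (f.app p x) := by
  ext q
  exact f.naturality q.2 x

theorem ShortExactOn.cofreeMap {f : Hom F G} {g : Hom G H} {U : Set P} (hU : IsUpperSet U)
    (h : ShortExactOn f g U) :
    ShortExactOn (PosetModule.cofreeMap f.app) (PosetModule.cofreeMap g.app) U where
  injective p hp s t hst := by
    ext q
    exact h.injective q (hU q.2 hp) (congrFun hst q)
  exact p hp s := by
    constructor
    · intro hs
      choose t ht using fun q : Set.Ici p =>
        (h.exact q (hU q.2 hp) (s q)).1 (congrFun hs q)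
      exact ⟨t, funext ht⟩
    · rintro ⟨t, rfl⟩
      ext q
      exact (h.exact q (hU q.2 hp) _).2 ⟨_, rfl⟩
  surjective p hp s := by
    choose t ht using fun q : Set.Ici p => h.surjective q (hU q.2 hp) (s q)
    exact ⟨t, funext ht⟩

/-- This is the nine lemma for the embeddings into products of skyscrapers. The value of `cofree` at
`p` involves every point above `p`, which is why `U` must be an upper set. -/
theorem ShortExactOn.coker {f : Hom F G} {g : Hom G H} {U : Set P} (hU : IsUpperSet U)
    (h : ShortExactOn f g U) : ShortExactOn f.coker g.coker U := by
  have hc := h.cofreeMap hU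
  refine ⟨fun p hp => ?_, fun p hp s => ⟨fun hs => ?_, ?_⟩, fun p hp s => ?_⟩
  · rw [← LinearMap.ker_eq_bot, LinearMap.ker_eq_bot']
    intro x hx
    obtain ⟨t, rfl⟩ := F.proj_surjective p x
    rw [Hom.coker_proj] at hx
    obtain ⟨y, hy⟩ := (G.exact_unit_proj p _).1 hx
    have h1 : H.unit.app p (g.app p y) = 0 := by
      rw [← Hom.cofreeMap_unit, hy]
      exact (hc.exact p hp _).2 ⟨t, rfl⟩
    rw [map_eq_zero_iff _ (H.unit_injective p)] at h1
    obtain ⟨x, rfl⟩ := (h.exact p hp _).1 h1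
    rw [← Hom.cofreeMap_unit] at hy
    exact (F.exact_unit_proj p _).2 ⟨x, hc.injective p hp hy⟩
  · obtain ⟨t, rfl⟩ := G.proj_surjective p s
    rw [Hom.coker_proj] at hs
    obtain ⟨y, hy⟩ := (H.exact_unit_proj p _).1 hs
    obtain ⟨y, rfl⟩ := h.surjective p hp y
    have h1 : (PosetModule.cofreeMap g.app).app p (t - G.unit.app p y) = 0 := by
      rw [map_sub, Hom.cofreeMap_unit, hy, sub_self]
    obtain ⟨t', ht'⟩ := (hc.exact p hp _).1 h1
    refine ⟨F.proj.app p t', ?_⟩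
    rw [Hom.coker_proj, ht', map_sub, (G.exact_unit_proj p _).2 ⟨y, rfl⟩, sub_zero]
  · rintro ⟨t, rfl⟩
    obtain ⟨t, rfl⟩ := F.proj_surjective p t
    rw [Hom.coker_proj, Hom.coker_proj, (hc.exact p hp _).2 ⟨t, rfl⟩, map_zero]
  · obtain ⟨t, rfl⟩ := H.proj_surjective p s
    obtain ⟨t, rfl⟩ := hc.surjective p hp t
    exact ⟨G.proj.app p t, rfl⟩

theorem ShortExactOn.cofreeMap_sections_surjective {f : Hom F G} {g : Hom G H} {U : Set P}
    (hU : IsUpperSet U) (h : ShortExactOn f g U) :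
    Function.Surjective ((PosetModule.cofreeMap g.app).sections U) := by
  intro s
  choose t ht using fun p : U => h.surjective p p.2 (cofreeSections H.obj hU s p)
  refine ⟨(cofreeSections G.obj hU).symm t, (cofreeSections H.obj hU).injective ?_⟩
  ext p
  exact ht p

/-- This is exactness of `H⁰(G) → H⁰(H) → H¹(F) → H¹(G)`, by a diagram chase in the Godement
resolutions. -/
theorem ShortExactOn.h1Vanishes {f : Hom F G} {g : Hom G H} {U : Set P} (hU : IsUpperSet U)
    (h : ShortExactOn f g U) (hG : G.H1Vanishes U)
    (hs : Function.Surjective (g.sections U)) : F.H1Vanishes U := by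
  intro x
  obtain ⟨y, hy⟩ := hG (f.coker.sections U x)
  have hc := h.cofreeMap hU
  have hk := h.coker hU
  have h1 : H.proj.sections U ((PosetModule.cofreeMap g.app).sections U y) = 0 := by
    have : H.proj.sections U ((PosetModule.cofreeMap g.app).sections U y) =
        g.coker.sections U (G.proj.sections U y) := rfl
    rw [this, hy]
    exact (hk.sections_exact _).2 ⟨x, rfl⟩
  obtain ⟨z, hz⟩ := ((H.shortExactOn_unit_proj U).sections_exact _).1 h1
  obtain ⟨w, rfl⟩ := hs z
  have h2 : (PosetModule.cofreeMap g.app).sections U (y - G.unit.sections U w) = 0 := by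
    rw [map_sub, sub_eq_zero, ← hz]
    exact Subtype.ext (funext fun p => (Hom.cofreeMap_unit g _ _).symm)
  obtain ⟨v, hv⟩ := (hc.sections_exact _).1 h2
  refine ⟨v, hk.sections_injective ?_⟩
  have h3 : f.coker.sections U (F.proj.sections U v) =
      G.proj.sections U ((PosetModule.cofreeMap f.app).sections U v) := rfl
  rw [h3, hv, map_sub, hy, ((G.shortExactOn_unit_proj U).sections_exact _).2 ⟨w, rfl⟩, sub_zero]

/-- Dimension shifting: with `G` acyclic, the cohomology of `H` in degree `i` controls that of `F`
in degree `i + 1`. The induction passes to cokernels; global lifting persists there because `H¹(H) =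
0` and sections of products of skyscrapers lift pointwise. -/
theorem ShortExactOn.acyclicUpTo {n : ℕ} {f : Hom F G} {g : Hom G H} {U : Set P}
    (hU : IsUpperSet U) (h : ShortExactOn f g U) (hG : ∀ n, AcyclicUpTo n G U)
    (hs : Function.Surjective (g.sections U)) (hH : AcyclicUpTo n H U) :
    AcyclicUpTo (n + 1) F U := by
  induction n generalizing F G H with
  | zero => exact ⟨h.h1Vanishes hU (hG 1).1 hs, trivial⟩
  | succ n ih =>
    refine ⟨h.h1Vanishes hU (hG 1).1 hs, ih (h.coker hU) (fun n => (hG (n + 1)).2) ?_ hH.2⟩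
    intro x
    obtain ⟨y, rfl⟩ := hH.1 x
    obtain ⟨z, rfl⟩ := h.cofreeMap_sections_surjective hU y
    exact ⟨G.proj.sections U z, rfl⟩

end ShortExact

/-! ### Direct images -/

section Pushforward

/-- The direct image of the restriction of `F` to `V`. -/
def pushforward (F : PosetModule A P) (V : Set P) : PosetModule A P where
  obj p := F.sections (Set.Ici p ∩ V)
  map h := F.restrict (Set.inter_subset_inter_left V (Set.Ici_subset_Ici.2 h))
  map_id _ _ := rfl
  map_map _ _ _ := rfl

/-- The direct image of the restriction of a morphism. -/
def Hom.pushforward {F G : PosetModule A P} (f : Hom F G) (V : Set P) :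
    Hom (F.pushforward V) (G.pushforward V) where
  app _ := f.sections _
  naturality _ _ := rfl

/-- The value of a direct image at `p`, as a module of sections. -/
def pushforwardObj (F : PosetModule A P) (V : Set P) (p : P) :
    (F.pushforward V).obj p ≃ₗ[A] F.sections (Set.Ici p ∩ V) :=
  LinearEquiv.refl A (F.sections (Set.Ici p ∩ V))

@[ext] theorem pushforward_ext {F : PosetModule A P} {V : Set P} {p : P}
    {s t : (F.pushforward V).obj p}
    (h : ∀ q, (F.pushforwardObj V p s).1 q = (F.pushforwardObj V p t).1 q) : s = t :=
  Subtype.ext (funext h)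

theorem pushforward_section_apply {F : PosetModule A P} {U V : Set P} (hVU : V ⊆ U)
    (s : (F.pushforward V).sections U) (p : U) (q : P) (hpq : p.1 ≤ q) (hq : q ∈ V) :
    (F.pushforwardObj V p (s.1 p)).1 ⟨q, hpq, hq⟩ =
      (F.pushforwardObj V q (s.1 ⟨q, hVU hq⟩)).1 ⟨q, le_rfl, hq⟩ := by
  rw [← s.2 p ⟨q, hVU hq⟩ hpq]
  rfl

/-- The sections of a direct image, for `V ⊆ U`. -/
def pushforwardSections (F : PosetModule A P) {U V : Set P} (hVU : V ⊆ U)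
    (s : (F.pushforward V).sections U) : F.sections V :=
  ⟨fun p => (F.pushforwardObj V p (s.1 ⟨p, hVU p.2⟩)).1 ⟨p, le_rfl, p.2⟩, fun p q h =>
    ((F.pushforwardObj V p (s.1 ⟨p, hVU p.2⟩)).2 ⟨p, le_rfl, p.2⟩ ⟨q, h, q.2⟩ h).trans
      (pushforward_section_apply hVU s ⟨p, hVU p.2⟩ q h q.2)⟩

/-- For `V ⊆ U`, a section over `U` of the direct image is determined by its diagonal values, which
form a section over `V`; lifting that section suffices. -/
theorem pushforward_sections_surjective {F G : PosetModule A P} (f : Hom F G) {U V : Set P}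
    (hVU : V ⊆ U) (hf : Function.Surjective (f.sections V)) :
    Function.Surjective ((f.pushforward V).sections U) := by
  intro s
  obtain ⟨t, ht⟩ := hf (G.pushforwardSections hVU s)
  refine ⟨⟨fun p => (F.pushforwardObj V p).symm (F.restrict Set.inter_subset_right t),
    fun _ _ _ => rfl⟩, Subtype.ext (funext fun p => ?_)⟩
  ext q
  rw [pushforward_section_apply hVU s p q q.2.1 q.2.2]
  exact congrFun (congrArg Subtype.val ht) ⟨q, q.2.2⟩

/-- The direct image of a skyscraper at a point of `V` is again a skyscraper. The retraction keeps,
for each `r ∈ V`, only the component at `r` of the entry indexed by `r`. -/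
theorem relInjective_pushforward_cofree (M : P → Type u) [∀ p, AddCommGroup (M p)]
    [∀ p, Module A (M p)] {V : Set P} (hV : IsUpperSet V) :
    ((cofree (A := A) M).pushforward V).RelInjective := by
  refine ⟨⟨fun p =>
    { toFun := fun t => ((cofree M).pushforwardObj V p).symm
        ⟨fun q r => ((cofree M).pushforwardObj V r (t ⟨r, q.2.1.trans r.2⟩)).1
          ⟨r, le_rfl, hV r.2 q.2.2⟩ ⟨r, le_rfl⟩, fun _ _ _ => rfl⟩
      map_add' := fun _ _ => rfl
      map_smul' := fun _ _ => rfl }, fun _ _ => rfl⟩, fun p x => ?_⟩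
  ext q r
  exact (cofree_section_apply M ((cofree M).pushforwardObj V p x) q
    ⟨r, q.2.1.trans r.2, hV r.2 q.2.2⟩ r.2).symm

/-- The Leray spectral sequence of the inclusion of `V` into `U`, when the higher direct images
vanish. -/
theorem AcyclicUpTo.pushforward {n : ℕ} {F : PosetModule A P} {U V : Set P} (hU : IsUpperSet U)
    (hV : IsUpperSet V) (hVU : V ⊆ U) (hFV : AcyclicUpTo n F V)
    (hF : ∀ p ∈ U, AcyclicUpTo n F (Set.Ici p ∩ V)) : AcyclicUpTo n (F.pushforward V) U := by
  induction n generalizing F with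
  | zero => trivial
  | succ n ih =>
    -- The direct image of the resolution step is right exact at `p` exactly because `H¹` vanishes
    -- over `Set.Ici p ∩ V`.
    have h : ShortExactOn (F.unit.pushforward V) (F.proj.pushforward V) U :=
      ⟨fun p _ => (F.shortExactOn_unit_proj _).sections_injective,
        fun p _ => (F.shortExactOn_unit_proj _).sections_exact, fun p hp => (hF p hp).1⟩
    exact h.acyclicUpTo hU (fun n => (relInjective_pushforward_cofree F.obj hV).acyclicUpTo n U)
      (pushforward_sections_surjective _ hVU hFV.1) (ih hFV.2 fun p hp => (hF p hp).2)

end Pushforward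

end PosetModule

/-! ### Base change and descent of acyclicity -/

theorem LinearMap.exists_comp_eq_of_ker_le {A M N K : Type*} [CommRing A] [AddCommGroup M]
    [Module A M] [AddCommGroup N] [Module A N] [AddCommGroup K] [Module A K] (g : M →ₗ[A] N)
    (hg : Function.Surjective g) (h : M →ₗ[A] K) (hk : ∀ x, g x = 0 → h x = 0) :
    ∃ k : N →ₗ[A] K, ∀ x, k (g x) = h x := by
  let e := g.quotKerEquivOfSurjective hg
  refine ⟨(LinearMap.ker g).liftQ h (fun x hx => hk x hx) ∘ₗ e.symm.toLinearMap, fun x => ?_⟩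
  have : e.symm (g x) = (LinearMap.ker g).mkQ x := by
    rw [LinearEquiv.symm_apply_eq]
    rfl
  rw [LinearMap.comp_apply, LinearEquiv.coe_coe, this]
  exact Submodule.liftQ_apply _ _ _

theorem TensorProduct.pi_lTensor_proj_bijective {A B ι : Type*} [CommRing A] [AddCommGroup B]
    [Module A B] [Finite ι] (M : ι → Type*) [∀ i, AddCommGroup (M i)] [∀ i, Module A (M i)] :
    Function.Bijective
      (LinearMap.pi fun i => (LinearMap.proj (R := A) (φ := M) i).lTensor B) := by
  classical
  have := Fintype.ofFinite ι
  have h : ∀ x, (LinearMap.pi fun i => (LinearMap.proj (R := A) (φ := M) i).lTensor B) x =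
      TensorProduct.piRight A A B M x := by
    intro x
    induction x with
    | zero => simp
    | add x y hx hy => rw [map_add, map_add, hx, hy]
    | tmul b m => ext i; simp
  rw [show ⇑(LinearMap.pi fun i => (LinearMap.proj (R := A) (φ := M) i).lTensor B) =
    TensorProduct.piRight A A B M from funext h]
  exact (TensorProduct.piRight A A B M).bijective

namespace PosetModule

variable {A : Type u} [CommRing A] {P : Type u}

section BaseChange

variable [Preorder P]

variable {B : Type u} [AddCommGroup B] [Module A B] {F G : PosetModule A P}

/-- A morphism from `B ⊗ F` to `G` which is an isomorphism over `U`. -/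
structure TensorIso (B : Type u) [AddCommGroup B] [Module A B] (F G : PosetModule A P)
    (U : Set P) where
  app : ∀ p, B ⊗[A] F.obj p →ₗ[A] G.obj p
  naturality : ∀ {p q : P} (h : p ≤ q) (x : B ⊗[A] F.obj p),
    app q ((F.map h).lTensor B x) = G.map h (app p x)
  bijective : ∀ p ∈ U, Function.Bijective (app p)

variable {U : Set P}

/-- The map from `B ⊗ ∏ F_p` to `∏ G_p`. -/
def TensorIso.pi (φ : TensorIso B F G U) (V : Set P) :
    B ⊗[A] ((p : V) → F.obj p) →ₗ[A] ((p : V) → G.obj p) :=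
  LinearMap.pi fun p => φ.app p ∘ₗ (LinearMap.proj p).lTensor B

theorem TensorIso.pi_apply (φ : TensorIso B F G U) (V : Set P)
    (x : B ⊗[A] ((p : V) → F.obj p)) (p : V) :
    φ.pi V x p = φ.app p ((LinearMap.proj p).lTensor B x) := rfl

theorem TensorIso.pi_bijective [Finite P] (φ : TensorIso B F G U) {V : Set P} (hV : V ⊆ U) :
    Function.Bijective (φ.pi V) := by
  have h := TensorProduct.pi_lTensor_proj_bijective (A := A) (B := B) (fun p : V => F.obj p)
  constructor
  · intro x y hxy
    refine h.1 (funext fun p => ?_)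
    exact (φ.bijective p (hV p.2)).1 (congrFun hxy p)
  · intro y
    choose z hz using fun p : V => (φ.bijective p (hV p.2)).2 (y p)
    obtain ⟨x, hx⟩ := h.2 z
    refine ⟨x, funext fun p => ?_⟩
    rw [pi_apply, ← hz]
    exact congrArg _ (congrFun hx p)

/-- The morphism from `B ⊗ ∏ F_q` to `∏ G_q`, on products of skyscrapers. -/
def TensorIso.onCofree (φ : TensorIso B F G U) (p : P) :
    B ⊗[A] (cofree (A := A) F.obj).obj p →ₗ[A] (cofree (A := A) G.obj).obj p :=
  φ.pi (Set.Ici p)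

theorem TensorIso.onCofree_apply (φ : TensorIso B F G U) (p : P)
    (x : B ⊗[A] (cofree (A := A) F.obj).obj p) (q : Set.Ici p) :
    φ.onCofree p x q = φ.app q ((LinearMap.lTensor B
      (LinearMap.proj q : ((q : Set.Ici p) → F.obj q) →ₗ[A] F.obj q)) x) := rfl

theorem TensorIso.pi_unit (φ : TensorIso B F G U) (p : P) (x : B ⊗[A] F.obj p) :
    φ.onCofree p ((F.unit.app p).lTensor B x) = G.unit.app p (φ.app p x) := by
  ext q
  rw [unit_app_apply, ← φ.naturality q.2, onCofree_apply]
  exact congrArg _ (LinearMap.lTensor_comp_apply B _ _ x).symm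

/-- Right exactness of the tensor product and its compatibility with finite products carry the
comparison to cokernels; flatness of `B` is not needed at this stage. -/
theorem TensorIso.exists_coker [Finite P] (φ : TensorIso B F G U) (hU : IsUpperSet U) :
    ∃ ψ : TensorIso B F.coker G.coker U, ∀ p x,
      ψ.app p ((F.proj.app p).lTensor B x) = G.proj.app p (φ.onCofree p x) := by
  have hex : ∀ p, Function.Exact ((F.unit.app p).lTensor B) ((F.proj.app p).lTensor B) :=
    fun p => lTensor_exact B (F.exact_unit_proj p) (F.proj_surjective p)
  have hsurj : ∀ p, Function.Surjective ((F.proj.app p).lTensor B) :=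
    fun p => LinearMap.lTensor_surjective B (F.proj_surjective p)
  have key : ∀ p, ∃ k : B ⊗[A] F.coker.obj p →ₗ[A] G.coker.obj p,
      ∀ x, k ((F.proj.app p).lTensor B x) = G.proj.app p (φ.onCofree p x) := by
    intro p
    refine LinearMap.exists_comp_eq_of_ker_le _ (hsurj p) (G.proj.app p ∘ₗ φ.onCofree p) ?_
    intro x hx
    obtain ⟨y, rfl⟩ := (hex p x).1 hx
    exact (G.exact_unit_proj p _).2 ⟨φ.app p y, (φ.pi_unit p y).symm⟩
  choose k hk using key
  refine ⟨⟨k, fun {p q} h x => ?_, fun p hp => ⟨?_, fun y => ?_⟩⟩, hk⟩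
  · obtain ⟨x, rfl⟩ := hsurj p x
    have h1 : (F.coker.map h).lTensor B ((F.proj.app p).lTensor B x) =
        (F.proj.app q).lTensor B (((cofree F.obj).map h).lTensor B x) := by
      rw [← LinearMap.lTensor_comp_apply, ← LinearMap.lTensor_comp_apply]
      rfl
    rw [h1, hk, hk, ← G.proj.naturality]
    refine congrArg _ ?_
    ext r
    exact congrArg _ (LinearMap.lTensor_comp_apply B _ _ x).symm
  · rw [← LinearMap.ker_eq_bot, LinearMap.ker_eq_bot']
    intro x hx
    obtain ⟨x, rfl⟩ := hsurj p x
    rw [hk] at hx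
    obtain ⟨y, hy⟩ := (G.exact_unit_proj p _).1 hx
    obtain ⟨y, rfl⟩ := (φ.bijective p hp).2 y
    rw [← φ.pi_unit] at hy
    exact (hex p _).2 ⟨y, (φ.pi_bijective (fun q hq => hU hq hp)).1 hy⟩
  · obtain ⟨y, rfl⟩ := G.proj_surjective p y
    obtain ⟨x, rfl⟩ := (φ.pi_bijective (fun q hq => hU hq hp)).2 y
    exact ⟨_, hk p x⟩

/-- Flat base change for the first cohomology group. -/
theorem TensorIso.lTensor_surjective [Finite P] [Module.Flat A B] (φ : TensorIso B F G U)
    (hU : IsUpperSet U) (hG : G.H1Vanishes U) :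
    Function.Surjective ((F.proj.sections U).lTensor B) := by
  obtain ⟨ψ, hψ⟩ := φ.exists_coker hU
  intro z
  -- Flatness of `B` enters here: it embeds `B ⊗ (sections)` into a product of values of `G.coker`.
  -- There `ρ z` is a section, which lifts because `H¹(G) = 0`, and the lift is carried back to `B ⊗
  -- ∏ F_p`.
  let ρ : B ⊗[A] F.coker.sections U →ₗ[A] ((p : U) → G.coker.obj p) :=
    ψ.pi U ∘ₗ (F.coker.sections U).subtype.lTensor B
  have hρ : Function.Injective ρ := (ψ.pi_bijective le_rfl).1.comp
    (Module.Flat.lTensor_preserves_injective_linearMap _ (Submodule.subtype_injective _))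
  have hρa : ∀ z (p : U), ρ z p = ψ.app p
      ((LinearMap.proj p ∘ₗ (F.coker.sections U).subtype).lTensor B z) := by
    intro z p
    rw [LinearMap.lTensor_comp]
    rfl
  obtain ⟨t, ht⟩ := hG ⟨ρ z, by
    intro p q h
    rw [hρa, hρa, ← ψ.naturality, ← LinearMap.lTensor_comp_apply]
    refine congrArg (fun l => ψ.app q (LinearMap.lTensor B l z)) ?_
    ext s
    exact s.2 p q h⟩
  obtain ⟨x, hx⟩ := (φ.pi_bijective le_rfl).2 (cofreeSections G.obj hU t)
  refine ⟨(cofreeSections F.obj hU).symm.toLinearMap.lTensor B x, hρ ?_⟩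
  have h1 : ρ z = (G.proj.sections U t).1 := congrArg Subtype.val ht.symm
  rw [h1]
  ext p
  rw [hρa, ← LinearMap.lTensor_comp_apply, ← LinearMap.lTensor_comp_apply, Hom.sections_apply,
    ← (cofreeSections G.obj hU).symm_apply_apply t, ← hx]
  let π : ((q : U) → F.obj q) →ₗ[A] (cofree (A := A) F.obj).obj p :=
    LinearMap.pi fun q : Set.Ici p.1 => LinearMap.proj (⟨q, hU q.2 p.2⟩ : U)
  have h2 : ((LinearMap.proj p ∘ₗ (F.coker.sections U).subtype) ∘ₗ F.proj.sections U) ∘ₗ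
      (cofreeSections F.obj hU).symm.toLinearMap = F.proj.app p ∘ₗ π := rfl
  rw [h2, LinearMap.lTensor_comp_apply]
  refine (hψ p _).trans (congrArg _ ?_)
  ext q
  exact congrArg _ (LinearMap.lTensor_comp_apply B _ _ x).symm

/-- Descent of acyclicity along a jointly faithfully flat family. -/
theorem acyclicUpTo_of_tensorIso [Finite P] {ι : Type*} (B : ι → Type u)
    [∀ i, AddCommGroup (B i)] [∀ i, Module A (B i)] [∀ i, Module.Flat A (B i)]
    (hB : ∀ (N : Type u) [AddCommGroup N] [Module A N],
      (∀ i, Subsingleton (B i ⊗[A] N)) → Subsingleton N)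
    (hU : IsUpperSet U) (n : ℕ) (F : PosetModule A P) (G : ι → PosetModule A P)
    (φ : ∀ i, TensorIso (B i) F (G i) U) (hG : ∀ i, AcyclicUpTo n (G i) U) :
    AcyclicUpTo n F U := by
  induction n generalizing F G with
  | zero => trivial
  | succ n ih =>
    choose ψ hψ using fun i => (φ i).exists_coker hU
    refine ⟨?_, ih F.coker _ ψ fun i => (hG i).2⟩
    -- The obstruction to `H¹(F) = 0` is the quotient by `R`; base change to each `B i` kills it, so
    -- it is zero.
    let R := LinearMap.range (F.proj.sections U)
    have : Subsingleton (F.coker.sections U ⧸ R) := by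
      refine hB _ fun i => subsingleton_of_forall_eq 0 fun x => ?_
      obtain ⟨x, rfl⟩ := LinearMap.lTensor_surjective (B i) (Submodule.mkQ_surjective R) x
      obtain ⟨x, rfl⟩ := (φ i).lTensor_surjective hU (hG i).1 x
      rw [← LinearMap.lTensor_comp_apply, LinearMap.range_mkQ_comp]
      simp
    rw [Submodule.Quotient.subsingleton_iff] at this
    exact LinearMap.range_eq_top.1 this

end BaseChange

end PosetModule

/-! ### Flatness of sections of acyclic systems -/

/-- The kernel of a surjection between flat modules is flat. -/
theorem Module.Flat.of_exact {A : Type u} [CommRing A] {K M N : Type u}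
    [AddCommGroup K] [Module A K] [AddCommGroup M] [Module A M] [AddCommGroup N] [Module A N]
    {f : K →ₗ[A] M} {g : M →ₗ[A] N} (hf : Function.Injective f) (hfg : Function.Exact f g)
    (hg : Function.Surjective g) [Module.Flat A M] [Module.Flat A N] : Module.Flat A K := by
  rw [Module.Flat.iff_rTensor_preserves_injective_linearMap]
  intro X Y _ _ _ _ i hi
  have h1 := LinearMap.lTensor_injective_of_exact_of_flat g hg f hf hfg X
  have h2 := Module.Flat.rTensor_preserves_injective_linearMap (M := M) i hi
  have h3 : Function.Injective (f.lTensor Y ∘ i.rTensor K) := by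
    rw [← LinearMap.coe_comp, LinearMap.lTensor_comp_rTensor, ← LinearMap.rTensor_comp_lTensor]
    exact h2.comp h1
  exact h3.of_comp

theorem Module.Flat.pi' {A : Type*} [CommRing A] {ι : Type*} [Finite ι] {M : ι → Type*}
    [∀ i, AddCommGroup (M i)] [∀ i, Module A (M i)] (h : ∀ i, Module.Flat A (M i)) :
    Module.Flat A ((i : ι) → M i) := by
  classical
  have := Fintype.ofFinite ι
  exact Module.Flat.of_linearEquiv (DFinsupp.linearEquivFunOnFintype (R := A) (M := M)).symm

namespace PosetModule

variable {A : Type u} [CommRing A] {P : Type u}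

/-- At a single point the embedding is split by evaluation at `p`, so the cokernel there is a direct
summand of a finite product of flat modules. -/
theorem coker_obj_flat [Preorder P] [Finite P] (F : PosetModule A P) {U : Set P}
    (hU : IsUpperSet U) (hF : ∀ p ∈ U, Module.Flat A (F.obj p)) (p : P) (hp : p ∈ U) :
    Module.Flat A (F.coker.obj p) := by
  classical
  have hf : ∀ q : Set.Ici p, Module.Flat A (F.obj q) := fun q => hF q (hU q.2 hp)
  have : Module.Flat A ((cofree (A := A) F.obj).obj p) :=
    Module.Flat.pi' hf
  let r : (cofree (A := A) F.obj).obj p →ₗ[A] F.obj p := LinearMap.proj (⟨p, le_rfl⟩ : Set.Ici p)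
  have hr : ∀ x, r (F.unit.app p x) = x := F.map_id p
  let i : F.coker.obj p →ₗ[A] (cofree (A := A) F.obj).obj p :=
    Submodule.liftQ _ (LinearMap.id - F.unit.app p ∘ₗ r) (by
      rintro _ ⟨x, rfl⟩
      simp [hr])
  refine Module.Flat.of_retract i (F.proj.app p) (LinearMap.ext fun x => ?_)
  obtain ⟨t, rfl⟩ := F.proj_surjective p x
  have h0 : F.proj.app p (F.unit.app p (r t)) = 0 := (F.exact_unit_proj p _).2 ⟨_, rfl⟩
  change F.proj.app p (t - F.unit.app p (r t)) = _
  rw [map_sub, h0, sub_zero]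
  rfl

theorem subsingleton_tensor_pi {ι : Type*} [Finite ι] (N : Type*) [AddCommGroup N] [Module A N]
    (M : ι → Type*) [∀ i, AddCommGroup (M i)] [∀ i, Module A (M i)]
    (h : ∀ i, Subsingleton (N ⊗[A] M i)) : Subsingleton (N ⊗[A] ((i : ι) → M i)) :=
  (TensorProduct.pi_lTensor_proj_bijective (A := A) (B := N) M).1.subsingleton

theorem subsingleton_tensor_coker [Preorder P] [Finite P] (F : PosetModule A P) {U : Set P}
    (hU : IsUpperSet U) (N : Type u) [AddCommGroup N] [Module A N]
    (hN : ∀ p ∈ U, Subsingleton (N ⊗[A] F.obj p)) (p : P) (hp : p ∈ U) :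
    Subsingleton (N ⊗[A] F.coker.obj p) := by
  have : Subsingleton (N ⊗[A] (cofree (A := A) F.obj).obj p) :=
    subsingleton_tensor_pi N (fun q : Set.Ici p => F.obj q) fun q => hN q (hU q.2 hp)
  exact (LinearMap.lTensor_surjective N (F.proj_surjective p)).subsingleton

/-- If all values strictly above `p` vanish, the product of skyscrapers at `p` reduces to `F.obj p`
and the embedding is onto. Each passage to the cokernel therefore removes the top layer of the
support, so the resolution is finite. -/
theorem subsingleton_coker [PartialOrder P] (F : PosetModule A P) (p : P)
    (hF : ∀ q, p < q → Subsingleton (F.obj q)) : Subsingleton (F.coker.obj p) := by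
  refine subsingleton_of_forall_eq 0 fun x => ?_
  obtain ⟨t, rfl⟩ := F.proj_surjective p x
  refine (F.exact_unit_proj p _).2 ⟨t ⟨p, le_rfl⟩, ?_⟩
  ext ⟨q, hq⟩
  obtain rfl | h := eq_or_lt_of_le (Set.mem_Ici.1 hq)
  · exact F.map_id _ _
  · have := hF q h
    exact Subsingleton.elim _ _

/-- The sections of an acyclic system of flat modules form a flat module, and they vanish after
tensoring with `N` if all the modules of the system do. -/
theorem sections_flat_and_subsingleton [PartialOrder P] [Finite P] {U : Set P}
    (hU : IsUpperSet U) (N : Type u) [AddCommGroup N] [Module A N] (F : PosetModule A P)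
    (hF : ∀ p ∈ U, Module.Flat A (F.obj p)) (hN : ∀ p ∈ U, Subsingleton (N ⊗[A] F.obj p))
    (ha : ∀ n, AcyclicUpTo n F U) :
    Module.Flat A (F.sections U) ∧ Subsingleton (N ⊗[A] F.sections U) := by
  -- The number `m` measures how many layers from the top are already zero, and each cokernel raises
  -- it by one. Once `m` reaches `Nat.card P`, the system vanishes on `U`. The case `m = 0` is
  -- vacuous since `p ∈ Set.Ici p`.
  suffices H : ∀ (k m : ℕ) (F : PosetModule A P), Nat.card P ≤ m + k →
      (∀ p ∈ U, (Set.Ici p).ncard ≤ m → Subsingleton (F.obj p)) →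
      (∀ p ∈ U, Module.Flat A (F.obj p)) → (∀ p ∈ U, Subsingleton (N ⊗[A] F.obj p)) →
      (∀ n, AcyclicUpTo n F U) →
      Module.Flat A (F.sections U) ∧ Subsingleton (N ⊗[A] F.sections U) by
    refine H (Nat.card P) 0 F (by simp) (fun p _ hp => ?_) hF hN ha
    rw [Nat.le_zero, Set.ncard_eq_zero] at hp
    exact absurd (Set.self_mem_Ici (a := p)) (by simp [hp])
  intro k
  induction k with
  | zero =>
    intro m F hm h0 _ _ _
    have : Subsingleton (F.sections U) := by
      refine subsingleton_of_forall_eq 0 fun s => Subtype.ext (funext fun p => ?_)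
      have := h0 p p.2 ((Set.ncard_le_card _).trans hm)
      exact Subsingleton.elim _ _
    refine ⟨inferInstance, subsingleton_of_forall_eq 0 fun x => ?_⟩
    induction x with
    | zero => rfl
    | add x y hx hy => rw [hx, hy, add_zero]
    | tmul n s => rw [Subsingleton.elim s 0, TensorProduct.tmul_zero]
  | succ k ih =>
    intro m F hm h0 hF hN ha
    have hz : ∀ p ∈ U, (Set.Ici p).ncard ≤ m + 1 → Subsingleton (F.coker.obj p) := by
      intro p hp hpm
      refine F.subsingleton_coker p fun q hq => h0 q (hU hq.le hp) ?_
      have : (Set.Ici q).ncard < (Set.Ici p).ncard :=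
        Set.ncard_lt_ncard (Set.Ici_ssubset_Ici.2 hq)
      omega
    obtain ⟨h1, h2⟩ := ih (m + 1) F.coker (by omega) hz
      (F.coker_obj_flat hU hF) (F.subsingleton_tensor_coker hU N hN) (fun n => (ha (n + 1)).2)
    have hflat : Module.Flat A ((cofree (A := A) F.obj).sections U) :=
      have := Module.Flat.pi' fun p : U => hF p p.2
      Module.Flat.of_linearEquiv (cofreeSections F.obj hU)
    have hsub : Subsingleton (N ⊗[A] (cofree (A := A) F.obj).sections U) :=
      have := subsingleton_tensor_pi N (fun p : U => F.obj p) fun p => hN p p.2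
      ((cofreeSections F.obj hU).lTensor N).injective.subsingleton
    -- Since `H¹(F) = 0`, the sections form a short exact sequence. Its last term is flat by
    -- induction, so the first term is flat and stays embedded in the middle one after tensoring
    -- with `N`.
    have hs := F.shortExactOn_unit_proj U
    exact ⟨Module.Flat.of_exact hs.sections_injective hs.sections_exact (ha 1).1,
      (LinearMap.lTensor_injective_of_exact_of_flat _ (ha 1).1 _ hs.sections_injective
        hs.sections_exact N).subsingleton⟩

end PosetModule

/-! ### Cohomology of flasque sheaves -/

/-- Sheaves of abelian groups. -/
abbrev AbSheaf (Y : TopCat.{u}) := Sheaf (Opens.grothendieckTopology Y) AddCommGrpCat.{u}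

namespace AbSheaf

variable {Y : TopCat.{u}}

/-- Short exactness of a complex of sheaves of abelian groups, in terms of sections. -/
theorem shortExact_of_sections (S : ShortComplex (AbSheaf Y))
    (h1 : ∀ U, Function.Injective (S.f.hom.app (op U)))
    (h2 : ∀ U (s : S.X₂.obj.obj (op U)), S.g.hom.app (op U) s = 0 →
      ∃ t, S.f.hom.app (op U) t = s)
    (h3 : ∀ (U) (s : S.X₃.obj.obj (op U)), ∀ y ∈ U, ∃ (V : Opens Y) (h : V ≤ U), y ∈ V ∧
      ∃ t, S.g.hom.app (op V) t = S.X₃.obj.map (homOfLE h).op s) : S.ShortExact := by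
  have hm : ∀ U, Mono (S.f.hom.app U) := fun U =>
    (AddCommGrpCat.mono_iff_injective _).2 (h1 U.unop)
  have hmono : Mono S.f.hom := NatTrans.mono_of_mono_app _
  have : Mono S.f := (sheafToPresheaf _ _).mono_of_mono_map hmono
  have hepi : Epi S.g := by
    refine (Sheaf.isLocallySurjective_iff_epi' ..).1 ?_
    refine (TopCat.Presheaf.isLocallySurjective_iff S.g.hom).2 ?_
    intro U t x hx
    obtain ⟨V, h, hxV, s, hs⟩ := h3 U t x hx
    exact ⟨V, h, ⟨s, hs⟩, hxV⟩
  -- A sectionwise kernel is a kernel of sheaves: factorisations are chosen on sections, and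
  -- injectivity of `S.f` makes them additive, natural and unique.
  refine ⟨ShortComplex.exact_of_f_is_kernel _ ?_⟩
  have hz : ∀ {W : AbSheaf Y} (k : W ⟶ S.X₂) (hk : k ≫ S.g = 0) (U)
      (x : W.obj.obj U), ∃ t, S.f.hom.app U t = k.hom.app U x := by
    intro W k hk U x
    refine h2 U.unop _ ?_
    have := congrArg (fun l => l.hom.app U x) hk
    exact this
  choose l hl using @hz
  refine Limits.KernelFork.IsLimit.ofι _ _ (fun {W} k hk => ⟨⟨fun U => AddCommGrpCat.ofHom
    { toFun := l k hk U, map_zero' := h1 U.unop ?_, map_add' := fun x y => h1 U.unop ?_ },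
    fun U V i => ?_⟩⟩) ?_ ?_
  · rw [hl, map_zero, map_zero]
  · rw [hl, map_add, map_add, hl, hl]
  · ext x
    refine h1 V.unop ?_
    have e1 := ConcreteCategory.congr_hom (S.f.hom.naturality i) (l k hk U x)
    have e2 := ConcreteCategory.congr_hom (k.hom.naturality i) x
    have e3 := hl k hk V (W.obj.map i x)
    have e4 := hl k hk U x
    refine e3.trans (e2.trans (Eq.trans ?_ e1.symm))
    exact congrArg (S.X₂.obj.map i) e4.symm
  · intro W k hk
    refine Sheaf.hom_ext (NatTrans.ext (funext fun U => ?_))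
    ext x
    exact hl k hk _ x
  · intro W k hk b hb
    rw [← cancel_mono S.f, hb]
    refine Sheaf.hom_ext (NatTrans.ext (funext fun U => ?_))
    ext x
    exact (hl k hk _ x).symm

/-- Injective sheaves are flasque. -/
theorem isFlasque_of_injective (J : AbSheaf Y) [Injective J] :
    TopCat.Presheaf.IsFlasque J.obj where
  epi {U V} i := by
    -- Sheafification preserves monomorphisms, so its right adjoint preserves injectives.
    have hJ : Injective J.obj := Injective.injective_of_adjoint
      (sheafificationAdjunction (Opens.grothendieckTopology Y) AddCommGrpCat.{u}) J
    rw [AddCommGrpCat.epi_iff_surjective]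
    intro s
    let Z : Opens Y → (Opens Y)ᵒᵖ ⥤ AddCommGrpCat.{u} := fun W => yoneda.obj W ⋙ AddCommGrpCat.free
    let z : Z V.unop ⟶ Z U.unop := Functor.whiskerRight (yoneda.map i.unop) AddCommGrpCat.free
    have hz : Mono z := by
      have : ∀ W, Mono (z.app W) := fun W => by
        have : Mono ((yoneda.map i.unop).app W) := inferInstance
        exact inferInstanceAs (Mono (AddCommGrpCat.free.map ((yoneda.map i.unop).app W)))
      exact NatTrans.mono_of_mono_app _
    -- By Yoneda, `s` is a morphism from the free presheaf on the smaller open set. Extending it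
    -- along the monomorphism `z` gives a section over the larger open set that restricts to `s`.
    let a : Z V.unop ⟶ J.obj :=
      { app := fun W => AddCommGrpCat.ofHom
          (FreeAbelianGroup.lift fun f : W.unop ⟶ V.unop => J.obj.map f.op s)
        naturality := fun W W' f => by
          refine AddCommGrpCat.hom_ext (FreeAbelianGroup.lift_ext _ _ fun g => ?_)
          change FreeAbelianGroup.lift _ (FreeAbelianGroup.map _ (FreeAbelianGroup.of g)) =
            J.obj.map f (FreeAbelianGroup.lift _ (FreeAbelianGroup.of g))
          rw [FreeAbelianGroup.map_of_apply, FreeAbelianGroup.lift_apply_of,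
            FreeAbelianGroup.lift_apply_of]
          exact ConcreteCategory.congr_hom (J.obj.map_comp g.op f) s }
    let b := Injective.factorThru a z
    have hb : z ≫ b = a := Injective.comp_factorThru a z
    refine ⟨b.app U (FreeAbelianGroup.of (𝟙 _)), ?_⟩
    have e1 := ConcreteCategory.congr_hom (b.naturality i) (FreeAbelianGroup.of (𝟙 _))
    refine e1.symm.trans ?_
    have e2 := ConcreteCategory.congr_hom (congrArg (fun l : Z V.unop ⟶ J.obj => l.app V) hb)
      (FreeAbelianGroup.of (𝟙 _))
    have e3 : a.app V (FreeAbelianGroup.of (𝟙 _)) = s := by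
      refine (FreeAbelianGroup.lift_apply_of _ _).trans ?_
      exact ConcreteCategory.congr_hom (J.obj.map_id V) s
    rw [← e3, ← e2]
    refine congrArg (b.app V) ?_
    change FreeAbelianGroup.map _ (FreeAbelianGroup.of _) =
      FreeAbelianGroup.map _ (FreeAbelianGroup.of _)
    rw [FreeAbelianGroup.map_of_apply, FreeAbelianGroup.map_of_apply]
    rfl

section LongExactSequence

variable {S : ShortComplex (AbSheaf Y)} (hS : S.ShortExact)
include hS

theorem subsingleton_H_one_iff (h : Subsingleton (Sheaf.H.{u} S.X₂ 1)) :
    Subsingleton (Sheaf.H.{u} S.X₁ 1) ↔ Function.Surjective (S.g.hom.app (op ⊤)) := by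
  have hT : Limits.IsTerminal (⊤ : Opens Y) := Limits.isTerminalTop
  constructor
  · intro h1 s
    obtain ⟨t, ht⟩ := Abelian.Ext.covariant_sequence_exact₃ _ hS ((Sheaf.H.equiv₀ S.X₃ hT).symm s)
      (zero_add 1) (Subsingleton.elim _ _)
    refine ⟨Sheaf.H.equiv₀ S.X₂ hT t, ?_⟩
    rw [Sheaf.H.equiv₀_naturality, Sheaf.H.map_apply, ht, AddEquiv.apply_symm_apply]
  · intro hs
    refine subsingleton_of_forall_eq 0 fun x => ?_
    obtain ⟨y, rfl⟩ := Abelian.Ext.covariant_sequence_exact₁ _ hS x (Subsingleton.elim _ _)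
      (zero_add 1)
    obtain ⟨t, ht⟩ := hs (Sheaf.H.equiv₀ S.X₃ hT y)
    have : y = ((Sheaf.H.equiv₀ S.X₂ hT).symm t).comp (Abelian.Ext.mk₀ S.g) (add_zero 0) := by
      rw [← Sheaf.H.map_apply, Sheaf.H.equiv₀_symm_naturality, ht, AddEquiv.symm_apply_apply]
    rw [this]
    simp

theorem subsingleton_H_add_two_iff (n : ℕ) (h1 : Subsingleton (Sheaf.H.{u} S.X₂ (n + 1)))
    (h2 : Subsingleton (Sheaf.H.{u} S.X₂ (n + 2))) :
    Subsingleton (Sheaf.H.{u} S.X₁ (n + 2)) ↔ Subsingleton (Sheaf.H.{u} S.X₃ (n + 1)) := by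
  constructor
  · intro h
    refine subsingleton_of_forall_eq 0 fun x => ?_
    obtain ⟨t, rfl⟩ := Abelian.Ext.covariant_sequence_exact₃ _ hS x (n₁ := n + 2) rfl
      (Subsingleton.elim _ _)
    rw [Subsingleton.elim t 0, Abelian.Ext.zero_comp]
  · intro h
    refine subsingleton_of_forall_eq 0 fun x => ?_
    obtain ⟨y, rfl⟩ := Abelian.Ext.covariant_sequence_exact₁ _ hS x (Subsingleton.elim _ _)
      (n₀ := n + 1) rfl
    rw [Subsingleton.elim y 0, Abelian.Ext.zero_comp]

end LongExactSequence

/-- Flasque sheaves are acyclic. -/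
theorem subsingleton_H_of_isFlasque (n : ℕ) (F : AbSheaf Y) [TopCat.Presheaf.IsFlasque F.obj] :
    Subsingleton (Sheaf.H.{u} F (n + 1)) := by
  let S : ShortComplex (AbSheaf Y) :=
    ShortComplex.mk (Injective.ι F) (Limits.cokernel.π (Injective.ι F)) (Limits.cokernel.condition _)
  have hS : S.ShortExact := { exact := ShortComplex.exact_cokernel _ }
  have h2 : TopCat.Presheaf.IsFlasque S.X₂.obj := isFlasque_of_injective (Injective.under F)
  have hI : Injective S.X₂ := inferInstanceAs (Injective (Injective.under F))
  -- As `F` is flasque, sections of the injective hull surject onto sections of the quotient. The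
  -- quotient is flasque too, so dimension shifting can recurse on it.
  have hg : ∀ U, Epi (S.g.hom.app (op U)) := fun U =>
    TopCat.Sheaf.IsFlasque.epi_of_shortExact (X := Y) (U := U) (S := S) hS
  have h3 : TopCat.Presheaf.IsFlasque S.X₃.obj :=
    TopCat.Sheaf.IsFlasque.of_shortExact_of_isFlasque₁₂ (X := Y) (S := S) hS
  match n with
  | 0 =>
    exact (subsingleton_H_one_iff hS inferInstance).2 ((AddCommGrpCat.epi_iff_surjective _).1 (hg ⊤))
  | n + 1 =>
    exact (subsingleton_H_add_two_iff hS n inferInstance inferInstance).2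
      (subsingleton_H_of_isFlasque n S.X₃)

end AbSheaf

/-! ### Comparison of poset cohomology with sheaf cohomology -/

/-- A model of the topological space `Y` by a part of the preorder `P`: the open subsets of `Y`
correspond to upper sets in `P`, and every point of an open subset has a neighbourhood
corresponding to a principal upper set. -/
structure PosetModel (Y : TopCat.{u}) (P : Type u) [Preorder P] where
  toSet : Opens Y → Set P
  isUpperSet : ∀ W, IsUpperSet (toSet W)
  mem_iSup : ∀ {ι : Type u} (W : ι → Opens Y) (p : P), p ∈ toSet (iSup W) → ∃ i, p ∈ toSet (W i)
  mem_inf : ∀ {V W : Opens Y} {p : P}, p ∈ toSet V → p ∈ toSet W → p ∈ toSet (V ⊓ W)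
  mono : ∀ {V W : Opens Y}, V ≤ W → toSet V ⊆ toSet W
  nhds : ∀ (W : Opens Y), ∀ y ∈ W, ∃ p, ∃ V ≤ W, y ∈ V ∧ toSet V = Set.Ici p

namespace PosetModule

variable {A : Type u} [CommRing A] {P : Type u} [Preorder P] {Y : TopCat.{u}}

/-- The presheaf of abelian groups associated to `F`. -/
def toPresheaf (m : PosetModel Y P) (F : PosetModule A P) : TopCat.Presheaf AddCommGrpCat.{u} Y where
  obj W := AddCommGrpCat.of (F.sections (m.toSet W.unop))
  map i := AddCommGrpCat.ofHom (F.restrict (m.mono i.unop.le)).toAddMonoidHom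
  map_id _ := rfl
  map_comp _ _ := rfl

theorem toPresheaf_isSheaf (m : PosetModel Y P) (F : PosetModule A P) :
    (F.toPresheaf m).IsSheaf := by
  rw [TopCat.Presheaf.isSheaf_iff_isSheafUniqueGluing]
  intro ι W sf hsf
  let sf' : ∀ i, F.sections (m.toSet (W i)) := sf
  have hsf' : ∀ i j p (hi : p ∈ m.toSet (W i)) (hj : p ∈ m.toSet (W j)),
      (sf' i).1 ⟨p, hi⟩ = (sf' j).1 ⟨p, hj⟩ := fun i j p hi hj =>
    congrFun (congrArg Subtype.val (hsf i j)) ⟨p, m.mem_inf hi hj⟩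
  choose i hi using fun p : m.toSet (iSup W) => m.mem_iSup W p p.2
  let s : F.sections (m.toSet (iSup W)) := ⟨fun p => (sf' (i p)).1 ⟨p, hi p⟩, fun p q h => by
    have hq : q.1 ∈ m.toSet (W (i p)) := m.isUpperSet _ h (hi p)
    exact ((sf' (i p)).2 ⟨p, hi p⟩ ⟨q, hq⟩ h).trans (hsf' _ _ q hq (hi q))⟩
  refine ⟨s, fun j => Subtype.ext (funext fun p => hsf' _ _ _ _ _), fun t ht => ?_⟩
  refine Subtype.ext (funext fun p => ?_)
  exact congrFun (congrArg Subtype.val (ht (i p))) ⟨p, hi p⟩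

/-- The sheaf of abelian groups associated to `F`. -/
def toSheaf (m : PosetModel Y P) (F : PosetModule A P) : AbSheaf Y :=
  ⟨F.toPresheaf m, F.toPresheaf_isSheaf m⟩

/-- The morphism of sheaves associated to a morphism. -/
def Hom.toSheaf (m : PosetModel Y P) {F G : PosetModule A P} (f : Hom F G) :
    F.toSheaf m ⟶ G.toSheaf m :=
  ⟨{ app := fun W => AddCommGrpCat.ofHom (f.sections (m.toSet W.unop)).toAddMonoidHom
     naturality := fun _ _ _ => rfl }⟩

/-- A section over a principal upper set is determined by its value at the least point, so it lifts
as soon as this value does. -/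
theorem sections_Ici_surjective {F G : PosetModule A P} (f : Hom F G) (p : P)
    (h : Function.Surjective (f.app p)) : Function.Surjective (f.sections (Set.Ici p)) := by
  intro s
  obtain ⟨x, hx⟩ := h (s.1 ⟨p, le_rfl⟩)
  refine ⟨⟨fun q => F.map q.2 x, fun q r h => F.map_map _ _ _⟩, Subtype.ext (funext fun q => ?_)⟩
  exact (f.naturality q.2 x).trans ((congrArg _ hx).trans (s.2 ⟨p, le_rfl⟩ q q.2))

theorem acyclicUpTo_Ici (n : ℕ) (F : PosetModule A P) (p : P) :
    AcyclicUpTo n F (Set.Ici p) := by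
  induction n generalizing F with
  | zero => trivial
  | succ n ih => exact ⟨sections_Ici_surjective _ _ (F.proj_surjective p), ih _⟩

/-- The short complex of sheaves `0 ⟶ F ⟶ cofree F ⟶ coker F ⟶ 0`. -/
def sheafComplex (m : PosetModel Y P) (F : PosetModule A P) : ShortComplex (AbSheaf Y) :=
  ShortComplex.mk (F.unit.toSheaf m) (F.proj.toSheaf m) (by
    refine Sheaf.hom_ext (NatTrans.ext (funext fun W => ?_))
    ext s
    exact ((F.shortExactOn_unit_proj _).sections_exact _).2 ⟨s, rfl⟩)

/-- Local surjectivity holds because every point has arbitrarily small neighbourhoods modelled by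
principal upper sets. -/
theorem sheafComplex_shortExact (m : PosetModel Y P) (F : PosetModule A P) :
    (F.sheafComplex m).ShortExact := by
  refine AbSheaf.shortExact_of_sections _ (fun W => ?_) (fun W s hs => ?_) fun W s y hy => ?_
  · exact (F.shortExactOn_unit_proj (m.toSet W)).sections_injective
  · exact ((F.shortExactOn_unit_proj (m.toSet W)).sections_exact s).1 hs
  · obtain ⟨p, V, hV, hyV, hp⟩ := m.nhds W y hy
    refine ⟨V, hV, hyV, ?_⟩
    have : Function.Surjective (F.proj.sections (m.toSet V)) := by
      rw [hp]
      exact sections_Ici_surjective _ _ (F.proj_surjective p)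
    exact this _

theorem isFlasque_cofree (m : PosetModel Y P) (M : P → Type u) [∀ p, AddCommGroup (M p)]
    [∀ p, Module A (M p)] :
    TopCat.Presheaf.IsFlasque ((cofree (A := A) M).toSheaf m).obj where
  epi {U V} i := by
    classical
    rw [AddCommGrpCat.epi_iff_surjective]
    intro s
    let e := cofreeSections (A := A) M (m.isUpperSet V.unop)
    let e' := cofreeSections (A := A) M (m.isUpperSet U.unop)
    -- A section of a product of skyscrapers is an arbitrary family, so it extends by zero.
    refine ⟨e'.symm fun p => if h : p.1 ∈ m.toSet V.unop then e s ⟨p, h⟩ else 0,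
      e.injective (funext fun p => ?_)⟩
    exact dif_pos p.2

/-- The cohomology of the sheaf associated to `F` vanishes in degrees `1, …, n` if and only if `F`
is acyclic up to degree `n`. -/
theorem forall_subsingleton_H_iff (m : PosetModel Y P) (n : ℕ) (F : PosetModule A P) :
    (∀ k < n, Subsingleton (Sheaf.H.{u} (F.toSheaf m) (k + 1))) ↔
      AcyclicUpTo n F (m.toSet ⊤) := by
  induction n generalizing F with
  | zero => simp [AcyclicUpTo]
  | succ n ih =>
    have := isFlasque_cofree (A := A) m F.obj
    have h2 : ∀ k, Subsingleton (Sheaf.H.{u} (F.sheafComplex m).X₂ (k + 1)) := fun k =>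
      AbSheaf.subsingleton_H_of_isFlasque k ((cofree (A := A) F.obj).toSheaf m)
    have hS := F.sheafComplex_shortExact m
    have e1 := AbSheaf.subsingleton_H_one_iff hS (h2 0)
    have e2 := fun k => AbSheaf.subsingleton_H_add_two_iff hS k (h2 k) (h2 (k + 1))
    have e3 : (F.H1Vanishes (m.toSet ⊤)) ↔ Subsingleton (Sheaf.H.{u} (F.toSheaf m) 1) := e1.symm
    rw [AcyclicUpTo, ← ih, e3]
    constructor
    · exact fun h => ⟨h 0 (by omega), fun k hk => (e2 k).1 (h (k + 1) (by omega))⟩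
    · rintro ⟨h1, h⟩ (_ | k) hk
      · exact h1
      · exact (e2 k).2 (h k (by omega))

end PosetModule

/-! ### The structure sheaf on the poset of the T₀ quotient -/

namespace FiniteRingedSpace

variable (X : RingedSpace.{u, u})

theorem res_res {U V W : Opens X} (h : V ≤ U) (h' : W ≤ V) (s : sections X U) :
    res X h' (res X h s) = res X (h'.trans h) s := by
  change (X.presheaf.map (homOfLE h).op ≫ X.presheaf.map (homOfLE h').op) s = _
  rw [← X.presheaf.map_comp]
  rfl

theorem res_self {U : Opens X} (h : U ≤ U) (s : sections X U) : res X h s = s := by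
  change X.presheaf.map (𝟙 _) s = s
  rw [X.presheaf.map_id]
  rfl

theorem res_bijective_of_eq {U V : Opens X} (h : V = U) : Function.Bijective (res X h.le) := by
  subst h
  have : ⇑(res X (le_refl V)) = id := funext fun s => res_self X _ s
  rw [this]
  exact Function.bijective_id

/-- The points of the `T₀` quotient of a finite ringed space. -/
def Pts : Type u := SeparationQuotient X

variable {X}

/-- A representative of a point of the `T₀` quotient. -/
def Pts.pt (p : Pts X) : X := Quotient.out (s := inseparableSetoid X) p

theorem exists_pts (x : X) : ∃ p : Pts X, Inseparable p.pt x :=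
  ⟨SeparationQuotient.mk x, Quotient.mk_out (s := inseparableSetoid X) x⟩

theorem Pts.ext {p q : Pts X} (h : Inseparable p.pt q.pt) : p = q := by
  rw [← Quotient.out_eq (s := inseparableSetoid X) p, ← Quotient.out_eq (s := inseparableSetoid X) q]
  exact Quotient.sound h

/-- The points in an open subset. -/
def ptsIn (U : Opens X) : Set (Pts X) := {p | p.pt ∈ U}

theorem mem_ptsIn {U : Opens X} {p : Pts X} : p ∈ ptsIn U ↔ p.pt ∈ U := Iff.rfl

/-- The sections over `U ∩ W`, as an algebra over the sections over `U`. -/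
def relSections (U W : Opens X) : Type u := sections X (U ⊓ W)

instance (U W : Opens X) : CommRing (relSections U W) :=
  inferInstanceAs (CommRing (sections X (U ⊓ W)))

instance (U W : Opens X) : Algebra (sections X U) (relSections U W) :=
  (res X inf_le_left).toAlgebra

/-- Restriction of sections over `U`-relative opens. -/
def relRes (U : Opens X) {V W : Opens X} (h : U ⊓ W ≤ V) :
    relSections U V →ₐ[sections X U] relSections U W :=
  { res X (le_inf inf_le_left h : U ⊓ W ≤ U ⊓ V) with
    commutes' := fun r => res_res X _ _ r }

theorem relRes_relRes (U : Opens X) {V W W' : Opens X} (h : U ⊓ W ≤ V) (h' : U ⊓ W' ≤ W)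
    (s : relSections U V) :
    relRes U h' (relRes U h s) = relRes U ((le_inf inf_le_left h').trans h) s :=
  res_res X _ _ s

variable [Finite X]

instance : Finite (Pts X) := inferInstanceAs (Finite (Quotient (inseparableSetoid X)))

theorem _root_.Inseparable.minOpen_eq {x y : X} (h : Inseparable x y) : minOpen X x = minOpen X y :=
  le_antisymm (minOpen_le X ((h.mem_open_iff (minOpen X y).isOpen).2 (mem_minOpen X y)))
    (minOpen_le X ((h.mem_open_iff (minOpen X x).isOpen).1 (mem_minOpen X x)))

/-- The order is chosen so that open sets become upper sets and `U_p` becomes `Set.Ici p`.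
Antisymmetry is what requires the T₀ quotient. -/
instance : PartialOrder (Pts X) where
  le p q := q.pt ∈ minOpen X p.pt
  le_refl p := mem_minOpen X p.pt
  le_trans _ _ _ h h' := minOpen_le X h h'
  le_antisymm p q h h' := Pts.ext (inseparable_iff_forall_isOpen.2 fun s hs =>
    ⟨fun hp => minOpen_le X (U := ⟨s, hs⟩) hp h, fun hq => minOpen_le X (U := ⟨s, hs⟩) hq h'⟩)

theorem Pts.le_iff {p q : Pts X} : p ≤ q ↔ q.pt ∈ minOpen X p.pt := Iff.rfl

theorem isUpperSet_ptsIn (U : Opens X) : IsUpperSet (ptsIn U) :=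
  fun _ _ h hp => minOpen_le X hp h

theorem exists_ptsIn_minOpen (x : X) : ∃ p : Pts X, p.pt ∈ minOpen X x ∧
    minOpen X p.pt = minOpen X x ∧ ptsIn (minOpen X x) = Set.Ici p := by
  obtain ⟨p, hp⟩ := exists_pts x
  have := hp.minOpen_eq
  refine ⟨p, this ▸ mem_minOpen X p.pt, this, ?_⟩
  ext q
  rw [mem_ptsIn, Set.mem_Ici, Pts.le_iff, this]

theorem sections_ext {U W : Opens X} {s t : sections X W} (hWU : W ≤ U)
    (h : ∀ (p : Pts X) (hp : p.pt ∈ W),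
      res X (inf_le_right.trans (minOpen_le X hp) : U ⊓ minOpen X p.pt ≤ W) s =
      res X (inf_le_right.trans (minOpen_le X hp) : U ⊓ minOpen X p.pt ≤ W) t) : s = t := by
  refine X.sheaf.eq_of_locally_eq' (fun p : ptsIn W => U ⊓ minOpen X p.1.pt) W
    (fun p => homOfLE (inf_le_right.trans (minOpen_le X p.2))) ?_ s t fun p => h p p.2
  intro x hx
  obtain ⟨p, hp⟩ := exists_pts x
  exact Opens.mem_iSup.2 ⟨⟨p, (hp.mem_open_iff W.isOpen).2 hx⟩, hWU hx,
    hp.minOpen_eq ▸ mem_minOpen X x⟩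

/-- Compatibility along `p ≤ q` is enough for gluing: the overlap of two minimal open sets is
covered by the minimal open sets of its own points. Intersecting with `U` changes no set, but
matches the values of `structureModule`. -/
theorem exists_sections {U W : Opens X} (hWU : W ≤ U)
    (s : ∀ p : ptsIn W, sections X (U ⊓ minOpen X p.1.pt))
    (hs : ∀ (p q : ptsIn W) (h : q.1.pt ∈ minOpen X p.1.pt),
      res X (inf_le_inf_left U (minOpen_le X h)) (s p) = s q) :
    ∃ t : sections X W, ∀ p : ptsIn W, res X (inf_le_right.trans (minOpen_le X p.2)) t = s p := by
  obtain ⟨t, ht, -⟩ := X.sheaf.existsUnique_gluing' (fun p : ptsIn W => U ⊓ minOpen X p.1.pt) W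
    (fun p => homOfLE (inf_le_right.trans (minOpen_le X p.2))) (by
      intro x hx
      obtain ⟨p, hp⟩ := exists_pts x
      exact Opens.mem_iSup.2 ⟨⟨p, (hp.mem_open_iff W.isOpen).2 hx⟩, hWU hx,
        hp.minOpen_eq ▸ mem_minOpen X x⟩) s (by
      intro p q
      refine sections_ext (U := U) (inf_le_left.trans inf_le_left) fun r hr => ?_
      have hp := hs p ⟨r, minOpen_le X p.2 hr.1.2⟩ hr.1.2
      have hq := hs q ⟨r, minOpen_le X q.2 hr.2.2⟩ hr.2.2
      exact (res_res X _ _ _).trans (hp.trans (hq.symm.trans (res_res X _ _ _).symm)))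
  exact ⟨t, ht⟩

/-- The structure sheaf over `U`, as a functor on the points of the `T₀` quotient. -/
def structureModule (U : Opens X) : PosetModule (sections X U) (Pts X) where
  obj p := relSections U (minOpen X p.pt)
  map h := (relRes U (inf_le_right.trans (minOpen_le X h))).toLinearMap
  map_id _ s := res_self X _ s
  map_map _ _ s := res_res X _ _ s

/-- The map from sections over `U ∩ W` to sections of the associated functor. -/
def toSections (U W : Opens X) (S : Set (Pts X)) (hS : ∀ p ∈ S, p.pt ∈ W) :
    relSections U W →ₗ[sections X U] (structureModule U).sections S where
  toFun s := ⟨fun p => relRes U (inf_le_right.trans (minOpen_le X (hS p p.2))) s,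
    fun _ _ _ => relRes_relRes U _ _ s⟩
  map_add' s t := Subtype.ext (funext fun _ => map_add _ s t)
  map_smul' a s := Subtype.ext (funext fun _ => map_smul _ a s)

theorem toSections_bijective (U W : Opens X) (S : Set (Pts X))
    (hS : ∀ p, p ∈ S ↔ p.pt ∈ U ⊓ W) :
    Function.Bijective (toSections U W S fun p hp => ((hS p).1 hp).2) := by
  constructor
  · intro s t hst
    refine sections_ext (U := U) (W := U ⊓ W) inf_le_left fun p hp => ?_
    exact congrFun (congrArg Subtype.val hst) ⟨p, (hS p).2 hp⟩
  · intro s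
    obtain ⟨t, ht⟩ := exists_sections (U := U) (W := U ⊓ W) inf_le_left
      (fun p => s.1 ⟨p, (hS p).2 p.2⟩) (fun p q h => s.2 ⟨p, (hS p).2 p.2⟩ ⟨q, (hS q).2 q.2⟩ h)
    exact ⟨t, Subtype.ext (funext fun p => ht ⟨p, (hS p).1 p.2⟩)⟩

end FiniteRingedSpace

namespace FiniteRingedSpace

variable {X : RingedSpace.{u, u}} [Finite X]

/-! ### Acyclicity of open subspaces in terms of the poset -/

section Comparison

variable {Z : RingedSpace.{u, u}} (f : Z.carrier ⟶ X.carrier) (hf : Topology.IsOpenEmbedding f)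

/-- The points of the `T₀` quotient of `X` form a model of every open subspace. -/
def posetModel : PosetModel Z.carrier (Pts X) where
  toSet W := ptsIn (hf.isOpenMap.functor.obj W)
  isUpperSet W := isUpperSet_ptsIn _
  mem_iSup W p := by
    rintro ⟨y, hy, h⟩
    obtain ⟨i, hi⟩ := Opens.mem_iSup.1 hy
    exact ⟨i, y, hi, h⟩
  mem_inf := by
    rintro V W p ⟨y, hy, h⟩ ⟨z, hz, h'⟩
    obtain rfl := hf.injective (h.trans h'.symm)
    exact ⟨y, ⟨hy, hz⟩, h⟩
  mono h := fun p ⟨y, hy, hp⟩ => ⟨y, h hy, hp⟩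
  nhds W y hy := by
    obtain ⟨p, -, -, hp⟩ := exists_ptsIn_minOpen (X := X) (f y)
    have hle : minOpen X (f y) ≤ hf.isOpenMap.functor.obj W := minOpen_le X ⟨y, hy, rfl⟩
    refine ⟨p, (Opens.map f).obj (minOpen X (f y)), fun z hz => ?_, mem_minOpen X _, ?_⟩
    · obtain ⟨w, hw, h⟩ := hle hz
      exact hf.injective h ▸ hw
    · rw [← hp]
      ext q
      constructor
      · rintro ⟨z, hz, h⟩
        exact (h ▸ hz : q.pt ∈ minOpen X (f y))
      · intro hq
        obtain ⟨w, -, h⟩ := hle hq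
        exact ⟨w, (h ▸ hq : f w ∈ minOpen X (f y)), h⟩

variable (e : Z.presheaf ≅ hf.isOpenMap.functor.op ⋙ X.presheaf) (U : Opens X)

/-- The comparison map, over an open subset. -/
def comparison (W : Opens Z) : sections Z W →+
    (structureModule U).sections ((posetModel f hf).toSet W) :=
  (toSections U (hf.isOpenMap.functor.obj W) (ptsIn (hf.isOpenMap.functor.obj W))
      fun _ h => h).toAddMonoidHom.comp
    ((res X inf_le_right : _ →+* sections X (U ⊓ hf.isOpenMap.functor.obj W)).comp
      (e.hom.app (op W)).hom).toAddMonoidHom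

theorem comparison_bijective (hU : ∀ z, f z ∈ U) (W : Opens Z) :
    Function.Bijective (comparison f hf e U W) := by
  have hW : hf.isOpenMap.functor.obj W ≤ U := by
    rintro _ ⟨z, -, rfl⟩
    exact hU z
  have h1 := toSections_bijective U (hf.isOpenMap.functor.obj W)
    (ptsIn (hf.isOpenMap.functor.obj W)) fun p => ⟨fun h => ⟨hW h, h⟩, fun h => h.2⟩
  have h2 := res_bijective_of_eq X (inf_eq_right.2 hW)
  have h3 : Function.Bijective (e.hom.app (op W)).hom :=
    ConcreteCategory.bijective_of_isIso (e.hom.app (op W))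
  exact h1.comp (h2.comp h3)

/-- The structure sheaf of an open subspace, in terms of the points of the `T₀` quotient. -/
def abSheafIso (hU : ∀ z, f z ∈ U) :
    abSheaf Z ≅ (structureModule U).toSheaf (posetModel f hf) :=
  (fullyFaithfulSheafToPresheaf _ _).preimageIso (NatIso.ofComponents
    (fun W => AddEquiv.toAddCommGrpIso
      (AddEquiv.ofBijective (comparison f hf e U W.unop) (comparison_bijective f hf e U hU W.unop)))
    (by
      intro V W i
      ext s
      refine Subtype.ext (funext fun p => ?_)
      have hp : U ⊓ minOpen X p.1.pt ≤ hf.isOpenMap.functor.obj W.unop :=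
        inf_le_right.trans (minOpen_le X (mem_ptsIn.1 p.2))
      have h1 : e.hom.app W (Z.presheaf.map i s) =
          res X (hf.isOpenMap.functor.map i.unop).le (e.hom.app V s) :=
        ConcreteCategory.congr_hom (e.hom.naturality i) s
      have h2 : ∀ (W' : Opens Z) (h : U ⊓ minOpen X p.1.pt ≤ hf.isOpenMap.functor.obj W')
          (t : sections X (hf.isOpenMap.functor.obj W')),
          relRes U h (res X (inf_le_right : U ⊓ hf.isOpenMap.functor.obj W' ≤ _) t) =
          res X h t := fun W' h t => res_res X _ _ t
      refine (h2 W.unop hp _).trans (Eq.trans ?_ (h2 V.unop (hp.trans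
        (hf.isOpenMap.functor.map i.unop).le) _).symm)
      exact (congrArg (res X hp) h1).trans (res_res X _ _ _)))

include e in
theorem isAcyclic_iff (hU : ∀ z, f z ∈ U) :
    IsAcyclic Z ↔ ∀ n, PosetModule.AcyclicUpTo n (structureModule U)
      (ptsIn (hf.isOpenMap.functor.obj ⊤)) := by
  let i := abSheafIso f hf e U hU
  have h : ∀ n, Subsingleton (Sheaf.H.{u} (abSheaf Z) n) ↔
      Subsingleton (Sheaf.H.{u} ((structureModule U).toSheaf (posetModel f hf)) n) := fun n =>
    ((Sheaf.functorH _ n).mapIso i).addCommGroupIsoToAddEquiv.toEquiv.subsingleton_congr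
  have h' := fun n => PosetModule.forall_subsingleton_H_iff (posetModel f hf) n (structureModule U)
  constructor
  · intro hZ n
    exact (h' n).1 fun k _ => (h _).1 (hZ (k + 1) k.succ_pos)
  · rintro hZ (_ | n) hn
    · exact absurd hn (lt_irrefl 0)
    · exact (h _).2 ((h' (n + 1)).2 (hZ (n + 1)) n n.lt_succ_self)

end Comparison

/-- The left side does not involve `U`, so acyclicity over `V` is independent of the coefficient
ring `𝒪(U)`. This permits changing `U` in the later induction. -/
theorem isAcyclic_openSubspace_iff {U V : Opens X} (h : V ≤ U) :
    IsAcyclic (openSubspace X V) ↔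
      ∀ n, PosetModule.AcyclicUpTo n (structureModule U) (ptsIn V) := by
  have := isAcyclic_iff (Z := openSubspace X V) V.inclusion' V.isOpenEmbedding (Iso.refl _) U
    fun z => h z.2
  have hV : V.isOpenEmbedding.isOpenMap.functor.obj ⊤ = V :=
    Opens.ext (Set.image_univ.trans Subtype.range_coe)
  exact this.trans (forall_congr' fun n => iff_of_eq (congrArg
    (fun W => PosetModule.AcyclicUpTo n (structureModule U) (ptsIn W)) hV))

theorem isAcyclic_iff_top :
    IsAcyclic X ↔ ∀ n, PosetModule.AcyclicUpTo n (structureModule (X := X) ⊤) (ptsIn ⊤) := by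
  have hf : Topology.IsOpenEmbedding (𝟙 X.carrier) := .id
  have hW : ∀ W : Opens X, hf.isOpenMap.functor.obj W = W := fun W =>
    Opens.ext (Set.image_id _)
  have := isAcyclic_iff (𝟙 X.carrier) hf (NatIso.ofComponents
    (fun W => X.presheaf.mapIso (eqToIso (hW W.unop).symm).op.symm) fun i => by
      dsimp
      rw [← X.presheaf.map_comp, ← X.presheaf.map_comp]
      rfl) ⊤ fun z => trivial
  rwa [hW] at this

end FiniteRingedSpace

/-! ### Faithfully flat families and ring epimorphisms -/

/-- Faithful flatness of a finite product. -/
theorem Module.FaithfullyFlat.pi_iff {A : Type u} [CommRing A] {ι : Type u} [Finite ι]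
    (M : ι → Type u) [∀ i, AddCommGroup (M i)] [∀ i, Module A (M i)] :
    Module.FaithfullyFlat A ((i : ι) → M i) ↔ (∀ i, Module.Flat A (M i)) ∧
      ∀ (N : Type u) [AddCommGroup N] [Module A N],
        (∀ i, Subsingleton (N ⊗[A] M i)) → Subsingleton N := by
  classical
  rw [Module.FaithfullyFlat.iff_flat_and_rTensor_reflects_triviality]
  constructor
  · rintro ⟨h1, h2⟩
    exact ⟨fun i => Module.Flat.of_retract (LinearMap.single A M i) (LinearMap.proj i)
        (LinearMap.proj_comp_single_same A M i),
      fun N _ _ hN => h2 N (PosetModule.subsingleton_tensor_pi N M hN)⟩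
  · rintro ⟨h1, h2⟩
    refine ⟨Module.Flat.pi' h1, fun N _ _ hN => h2 N fun i => ?_⟩
    have : Function.Surjective (LinearMap.proj (R := A) (φ := M) i) :=
      LinearMap.proj_surjective i
    exact (LinearMap.lTensor_surjective N this).subsingleton

/-- For an epimorphism `R → S`, the `S`-module `T` is its own base change `S ⊗[R] T`, and base
change preserves flatness. -/
theorem Module.Flat.of_isEpi (R S T : Type u) [CommRing R] [CommRing S] [CommRing T] [Algebra R S]
    [Algebra S T] [Algebra R T] [IsScalarTower R S T] [Algebra.IsEpi R S] [Module.Flat R T] :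
    Module.Flat S T :=
  Module.Flat.of_linearEquiv (TensorProduct.lid' R S T).symm

/-- The two inclusions of `S` into `S ⊗[R] S` agree after composition with `φ`, because they do so
on each of the epimorphic factors `B` and `C`. -/
theorem Algebra.IsEpi.of_tensorProduct_surjective {R B C S : Type u} [CommRing R] [CommRing B]
    [CommRing C] [CommRing S] [Algebra R B] [Algebra R C] [Algebra R S] [Algebra.IsEpi R B]
    [Algebra.IsEpi R C] (φ : B ⊗[R] C →ₐ[R] S) (hφ : Function.Surjective φ) :
    Algebra.IsEpi R S := by
  have h : (Algebra.TensorProduct.includeRight : S →ₐ[R] S ⊗[R] S).comp φ =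
      (Algebra.TensorProduct.includeLeft : S →ₐ[R] S ⊗[R] S).comp φ := by
    ext b
    · let f := φ.comp (Algebra.TensorProduct.includeLeft : B →ₐ[R] B ⊗[R] C)
      simpa [f, ← Algebra.TensorProduct.one_def] using congrArg (Algebra.TensorProduct.map f f)
        ((Algebra.isEpi_iff_forall_one_tmul_eq R B).1 inferInstance b)
    · let f := φ.comp (Algebra.TensorProduct.includeRight : C →ₐ[R] B ⊗[R] C)
      simpa [f, ← Algebra.TensorProduct.one_def] using congrArg (Algebra.TensorProduct.map f f)
        ((Algebra.isEpi_iff_forall_one_tmul_eq R C).1 inferInstance b)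
  rw [Algebra.isEpi_iff_forall_one_tmul_eq]
  intro a
  obtain ⟨a, rfl⟩ := hφ a
  exact DFunLike.congr_fun h a

/-! ### Acyclicity and faithful flatness for open subsets -/

namespace FiniteRingedSpace

variable {X : RingedSpace.{u, u}}

/-- Multiplication of restrictions, relative to `U`. -/
def relMul (U V W : Opens X) :
    relSections U V ⊗[sections X U] relSections U W →ₐ[sections X U] relSections U (V ⊓ W) :=
  Algebra.TensorProduct.productMap (relRes U (inf_le_right.trans inf_le_left))
    (relRes U (inf_le_right.trans inf_le_right))

theorem relMul_tmul (U V W : Opens X) (a : relSections U V) (b : relSections U W) :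
    relMul U V W (a ⊗ₜ b) = relRes U (inf_le_right.trans inf_le_left) a *
      relRes U (inf_le_right.trans inf_le_right) b := rfl

theorem relRes_relMul_lTensor (U : Opens X) {V W W' Q : Opens X} (h : U ⊓ W' ≤ W)
    (hQ : U ⊓ Q ≤ V ⊓ W') (t : relSections U V ⊗[sections X U] relSections U W) :
    relRes U hQ (relMul U V W' ((relRes U h).toLinearMap.lTensor _ t)) =
      relRes U (le_inf (hQ.trans inf_le_left)
        ((le_inf inf_le_left (hQ.trans inf_le_right)).trans h)) (relMul U V W t) := by
  induction t with
  | zero => simp only [map_zero]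
  | add s t hs ht => simp only [map_add, hs, ht]
  | tmul a b =>
    rw [LinearMap.lTensor_tmul, AlgHom.toLinearMap_apply, relMul_tmul, relMul_tmul, map_mul,
      map_mul, relRes_relRes, relRes_relRes, relRes_relRes, relRes_relRes, relRes_relRes]

variable [Finite X]

theorem faithfullyFlat_toProd_iff (U : Opens X) :
    (toProd X U).FaithfullyFlat ↔
      (∀ z : U, Module.Flat (sections X U) (relSections U (minOpen X z.1))) ∧
      ∀ (N : Type u) [AddCommGroup N] [Module (sections X U) N],
        (∀ z : U, Subsingleton (N ⊗[sections X U] relSections U (minOpen X z.1))) →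
          Subsingleton N := by
  rw [← Module.FaithfullyFlat.pi_iff, ← RingHom.faithfullyFlat_algebraMap_iff]
  let e : ((z : U) → localRing X z.1) ≃+* ((z : U) → relSections U (minOpen X z.1)) :=
    RingEquiv.piCongrRight fun z => RingEquiv.ofBijective
      (res X inf_le_right : sections X (minOpen X z.1) →+* sections X (U ⊓ minOpen X z.1))
      (res_bijective_of_eq X (inf_eq_right.2 (minOpen_le X z.2)))
  have he : (e : _ →+* _).comp (toProd X U) =
      algebraMap (sections X U) ((z : U) → relSections U (minOpen X z.1)) :=
    RingHom.ext fun s => funext fun z => res_res X _ _ s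
  have he' : (e.symm : _ →+* _).comp (algebraMap (sections X U)
      ((z : U) → relSections U (minOpen X z.1))) = toProd X U := by
    rw [← he]
    exact RingHom.ext fun s => e.symm_apply_apply _
  constructor
  · intro h
    rw [← he]
    exact RingHom.FaithfullyFlat.stableUnderComposition _ _ h (.of_bijective e.bijective)
  · intro h
    rw [← he']
    exact RingHom.FaithfullyFlat.stableUnderComposition _ _ h (.of_bijective e.symm.bijective)

/-- The tensor product over `𝒪(X)` surjects onto the one over `𝒪(U)`, and composing with
multiplication gives a bijection; hence multiplication over `𝒪(U)` is bijective as well. -/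
theorem TensorEqInter.relMul_bijective {x y : X} (h : TensorEqInter X x y) {U : Opens X}
    (hx : x ∈ U) (hy : y ∈ U) :
    Function.Bijective (relMul U (minOpen X x) (minOpen X y)) := by
  let _ := globalAlgebra X (minOpen X x)
  let _ := globalAlgebra X (minOpen X y)
  let _ := globalAlgebra X (interOpen X x y)
  let i (V : Opens X) : sections X V →+* relSections U V := res X inf_le_right
  have hi (V : Opens X) (hV : V ≤ U) : Function.Bijective (i V) :=
    res_bijective_of_eq X (inf_eq_right.2 hV)
  let Θ : localRing X x ⊗[sections X ⊤] localRing X y →+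
      relSections U (minOpen X x) ⊗[sections X U] relSections U (minOpen X y) :=
    TensorProduct.liftAddHom
      (AddMonoidHom.mk' (fun a => AddMonoidHom.mk' (fun b => i _ a ⊗ₜ i _ b)
        fun b b' => by rw [map_add, TensorProduct.tmul_add])
        fun a a' => by
          ext b
          change i _ (a + a') ⊗ₜ i _ b = i _ a ⊗ₜ i _ b + i _ a' ⊗ₜ i _ b
          rw [map_add, TensorProduct.add_tmul])
      fun r a b => by
        have key (V : Opens X) (s : sections X V) : i V (res X le_top r * s) =
            (res X le_top r : sections X U) • i V s := by
          rw [map_mul, Algebra.smul_def]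
          exact congrArg (· * _) ((res_res X _ _ r).trans (res_res X _ _ r).symm)
        change i _ (res X le_top r * a) ⊗ₜ i _ b = i _ a ⊗ₜ i _ (res X le_top r * b)
        rw [key, key, TensorProduct.smul_tmul]
  have hΘ : ∀ a b, Θ (a ⊗ₜ b) = i _ a ⊗ₜ i _ b := fun a b => rfl
  have hsurj : Function.Surjective Θ := by
    intro t
    induction t with
    | zero => exact ⟨0, map_zero _⟩
    | add s t hs ht =>
      obtain ⟨s, rfl⟩ := hs
      obtain ⟨t, rfl⟩ := ht
      exact ⟨s + t, map_add _ _ _⟩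
    | tmul a b =>
      obtain ⟨a, rfl⟩ := (hi _ (minOpen_le X hx)).2 a
      obtain ⟨b, rfl⟩ := (hi _ (minOpen_le X hy)).2 b
      exact ⟨a ⊗ₜ b, hΘ a b⟩
  let m := Algebra.TensorProduct.productMap
      (resAlgHom X (inf_le_left : interOpen X x y ≤ minOpen X x))
      (resAlgHom X (inf_le_right : interOpen X x y ≤ minOpen X y))
  have hm : Function.Bijective m := h
  have hcomm : ∀ t, relMul U _ _ (Θ t) = i (interOpen X x y) (m t) := by
    intro t
    induction t with
    | zero => simp only [map_zero]
    | add s t hs ht => simp only [map_add, hs, ht]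
    | tmul a b =>
      rw [hΘ, relMul_tmul, Algebra.TensorProduct.productMap_apply_tmul, map_mul]
      exact congrArg₂ (· * ·) ((res_res X _ _ a).trans (res_res X _ _ a).symm)
        ((res_res X _ _ b).trans (res_res X _ _ b).symm)
  have hinter := hi (interOpen X x y) (inf_le_left.trans (minOpen_le X hx))
  constructor
  · rw [injective_iff_map_eq_zero]
    intro t ht
    obtain ⟨t, rfl⟩ := hsurj t
    rw [hcomm] at ht
    have h0 : t = 0 := hm.1 (hinter.1 (by rw [ht, map_zero, map_zero]))
    rw [h0, map_zero]
  · intro t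
    obtain ⟨s, rfl⟩ := hinter.2 t
    obtain ⟨s, rfl⟩ := hm.2 s
    exact ⟨Θ s, hcomm s⟩

/-- The isomorphism between a base change of the structure sheaf and a direct image. -/
def structureTensorIso (htensor : ∀ x y : X, TensorEqInter X x y) (U : Opens X) (y : U) :
    PosetModule.TensorIso (relSections U (minOpen X y.1)) (structureModule U)
      ((structureModule U).pushforward (ptsIn (minOpen X y.1))) (ptsIn U) where
  app p := toSections U (minOpen X y.1 ⊓ minOpen X p.pt)
      (Set.Ici p ∩ ptsIn (minOpen X y.1)) (fun q hq => ⟨hq.2, hq.1⟩) ∘ₗ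
    (relMul U (minOpen X y.1) (minOpen X p.pt)).toLinearMap
  naturality {p q} h t := by
    refine Subtype.ext (funext fun r => ?_)
    have hr : U ⊓ minOpen X r.1.pt ≤ minOpen X y.1 ⊓ minOpen X q.pt :=
      le_inf (inf_le_right.trans (minOpen_le X r.2.2)) (inf_le_right.trans (minOpen_le X r.2.1))
    exact relRes_relMul_lTensor U _ hr t
  bijective p hp := by
    have h1 := (htensor y p.pt).relMul_bijective y.2 hp
    have h2 := toSections_bijective U (minOpen X y.1 ⊓ minOpen X p.pt)
      (Set.Ici p ∩ ptsIn (minOpen X y.1))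
      fun q => ⟨fun hq => ⟨minOpen_le X hp hq.1, hq.2, hq.1⟩, fun hq => ⟨hq.2.2, hq.2.1⟩⟩
    exact h2.comp h1

theorem acyclicUpTo_ptsIn_minOpen (n : ℕ) (U : Opens X) (x : X) :
    PosetModule.AcyclicUpTo n (structureModule U) (ptsIn (minOpen X x)) := by
  obtain ⟨p, -, -, hp⟩ := exists_ptsIn_minOpen x
  rw [hp]
  exact PosetModule.acyclicUpTo_Ici n _ p

/-- An open subset satisfying the affineness conditions is acyclic. -/
theorem acyclicUpTo_of_faithfullyFlat (htensor : ∀ x y : X, TensorEqInter X x y)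
    (hff : ∀ x y : X, (toProd X (interOpen X x y)).FaithfullyFlat) (U : Opens X)
    (hU : (toProd X U).FaithfullyFlat) (n : ℕ) :
    PosetModule.AcyclicUpTo n (structureModule U) (ptsIn U) := by
  have : Finite (Opens X) := Finite.of_injective _ SetLike.coe_injective
  induction U using WellFoundedLT.induction generalizing n with
  | ind U ih =>
  obtain ⟨h1, h2⟩ := (faithfullyFlat_toProd_iff U).1 hU
  -- Descent along the stalks `𝒪_y`, `y ∈ U`: it remains to see that the direct image from each
  -- `U_y` is acyclic on `U`.
  refine PosetModule.acyclicUpTo_of_tensorIso (fun y : U => relSections U (minOpen X y.1))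
    (fun N _ _ hN => h2 N fun z => ?_) (isUpperSet_ptsIn U) n _ _
    (structureTensorIso htensor U) fun y => ?_
  · have := hN z
    exact (TensorProduct.comm (sections X U) _ _).symm.injective.subsingleton
  · have hy : minOpen X y.1 ≤ U := minOpen_le X y.2
    refine PosetModule.AcyclicUpTo.pushforward (isUpperSet_ptsIn U) (isUpperSet_ptsIn _)
      (fun q hq => hy hq) (acyclicUpTo_ptsIn_minOpen n U y.1) fun p hp => ?_
    have hle : interOpen X p.pt y.1 ≤ U := inf_le_right.trans hy
    have hset : Set.Ici p ∩ ptsIn (minOpen X y.1) = ptsIn (interOpen X p.pt y.1) := rfl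
    rw [hset]
    -- Either `U_p ∩ U_y` is smaller than `U` and the induction hypothesis applies, or it equals
    -- `U`, which then coincides with `U_y`.
    obtain hlt | heq := lt_or_eq_of_le hle
    · exact (isAcyclic_openSubspace_iff hle).1 ((isAcyclic_openSubspace_iff le_rfl).2
        fun n => ih _ hlt (hff _ _) n) n
    · have : interOpen X p.pt y.1 = minOpen X y.1 :=
        le_antisymm inf_le_right (hy.trans heq.ge)
      rw [this]
      exact acyclicUpTo_ptsIn_minOpen n U y.1

/-- An acyclic open subset which is flat over its sections is faithfully flat. -/
theorem faithfullyFlat_of_acyclicUpTo (U : Opens X)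
    (hflat : ∀ z : U, Module.Flat (sections X U) (relSections U (minOpen X z.1)))
    (hU : ∀ n, PosetModule.AcyclicUpTo n (structureModule U) (ptsIn U)) :
    (toProd X U).FaithfullyFlat := by
  refine (faithfullyFlat_toProd_iff U).2 ⟨hflat, fun N _ _ hN => ?_⟩
  have := (PosetModule.sections_flat_and_subsingleton (isUpperSet_ptsIn U) N (structureModule U)
    (fun p hp => hflat ⟨p.pt, hp⟩) (fun p hp => hN ⟨p.pt, hp⟩) hU).2
  have hb := (toSections_bijective U U (ptsIn U) fun p => ⟨fun h => ⟨h, h⟩, fun h => h.2⟩).comp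
    (res_bijective_of_eq X (inf_idem U))
  -- The sheaf condition identifies `𝒪(U)` with the sections of the system, so `N ⊗ 𝒪(U) = N`
  -- vanishes.
  let e : sections X U →ₗ[sections X U] (structureModule U).sections (ptsIn U) :=
    toSections U U (ptsIn U) (fun _ h => h) ∘ₗ Algebra.linearMap _ (relSections U U)
  let e' := LinearEquiv.ofBijective e hb
  exact ((TensorProduct.rid (sections X U) N).symm ≪≫ₗ e'.lTensor N).injective.subsingleton

/-- Both `1 ⊗ a` and `a ⊗ 1` multiply to the restriction of `a`, so injectivity of the
multiplication identifies them. -/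
theorem TensorEqInter.isEpi {x : X} (h : TensorEqInter X x x) :
    letI := globalAlgebra X (minOpen X x)
    Algebra.IsEpi (sections X ⊤) (localRing X x) := by
  let _ := globalAlgebra X (minOpen X x)
  let _ := globalAlgebra X (interOpen X x x)
  rw [Algebra.isEpi_iff_forall_one_tmul_eq]
  intro a
  refine h.1 ?_
  rw [Algebra.TensorProduct.productMap_apply_tmul, Algebra.TensorProduct.productMap_apply_tmul,
    map_one, one_mul]
  exact (mul_one _).symm

theorem flat_res_inf (hX : IsFlatOverGlobal X) {U : Opens X} {z : X} (hz : z ∈ U) :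
    (res X (le_top : U ⊓ minOpen X z ≤ ⊤)).Flat := by
  have := (hX z).comp (RingHom.Flat.of_bijective
    (res_bijective_of_eq X (inf_eq_right.2 (minOpen_le X hz))))
  have h : (res X (inf_le_right : U ⊓ minOpen X z ≤ _)).comp (res X le_top) = res X le_top :=
    RingHom.ext fun s => res_res X _ _ s
  rwa [h] at this

/-- The map `𝒪(X) → 𝒪(U_x ∩ U_y)` is an epimorphism, being covered by the tensor product of two
epimorphisms. Flatness over `𝒪(X)` therefore passes to `𝒪(U_x ∩ U_y)`. -/
theorem flat_relSections_interOpen (hX : IsFlatOverGlobal X)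
    (htensor : ∀ x y : X, TensorEqInter X x y) (x y : X) (z : interOpen X x y) :
    Module.Flat (sections X (interOpen X x y))
      (relSections (interOpen X x y) (minOpen X z.1)) := by
  let _ := globalAlgebra X (minOpen X x)
  let _ := globalAlgebra X (minOpen X y)
  let _ := globalAlgebra X (interOpen X x y)
  have := (htensor x x).isEpi
  have := (htensor y y).isEpi
  have : Algebra.IsEpi (sections X ⊤) (sections X (interOpen X x y)) :=
    Algebra.IsEpi.of_tensorProduct_surjective _ (htensor x y).2
  let _ : Algebra (sections X ⊤) (relSections (interOpen X x y) (minOpen X z.1)) :=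
    (res X le_top).toAlgebra
  have : IsScalarTower (sections X ⊤) (sections X (interOpen X x y))
      (relSections (interOpen X x y) (minOpen X z.1)) :=
    IsScalarTower.of_algebraMap_eq fun s => (res_res X _ _ s).symm
  have : Module.Flat (sections X ⊤) (relSections (interOpen X x y) (minOpen X z.1)) :=
    flat_res_inf hX z.2
  exact Module.Flat.of_isEpi (sections X ⊤) _ _

theorem flat_relSections_top (hX : IsFlatOverGlobal X) (z : X) :
    Module.Flat (sections X (⊤ : Opens X)) (relSections ⊤ (minOpen X z)) :=
  flat_res_inf hX (U := ⊤) trivial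

end FiniteRingedSpace

end

theorem mainTheorem3 (X : AlgebraicGeometry.RingedSpace.{u, u}) [Finite X]
    (hX : FiniteRingedSpace.IsFlatOverGlobal X) :
    FiniteRingedSpace.IsAffine X ↔
      FiniteRingedSpace.IsAcyclic X ∧
      (∀ x y : X, FiniteRingedSpace.TensorEqInter X x y) ∧
      (∀ x y : X, FiniteRingedSpace.IsAcyclic
        (FiniteRingedSpace.openSubspace X (FiniteRingedSpace.interOpen X x y))) := by
  constructor
  · rintro ⟨h1, h2, h3⟩
    exact ⟨FiniteRingedSpace.isAcyclic_iff_top.2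
        (FiniteRingedSpace.acyclicUpTo_of_faithfullyFlat h2 h3 ⊤ h1), h2,
      fun x y => (FiniteRingedSpace.isAcyclic_openSubspace_iff le_rfl).2
        (FiniteRingedSpace.acyclicUpTo_of_faithfullyFlat h2 h3 _ (h3 x y))⟩
  · rintro ⟨h1, h2, h3⟩
    exact ⟨FiniteRingedSpace.faithfullyFlat_of_acyclicUpTo ⊤
        (fun z => FiniteRingedSpace.flat_relSections_top hX z.1)
        (FiniteRingedSpace.isAcyclic_iff_top.1 h1), h2,
      fun x y => FiniteRingedSpace.faithfullyFlat_of_acyclicUpTo _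
        (FiniteRingedSpace.flat_relSections_interOpen hX h2 x y)
        ((FiniteRingedSpace.isAcyclic_openSubspace_iff le_rfl).1 (h3 x y))⟩
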